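/- **Setting.** Let $\mathcal X\subseteq\mathbb R^d$ be nonempty, closed and convex, let $f,r:\mathbb R^d\to\mathbb R$ be convex, $F=f+r$, and let $x_\star\in\mathcal X$ be a minimizer of $F$ over $\mathcal X$, $F_\star=F(x_\star)$. For $x\in\mathcal X$ let $\nabla f(x)$ denote a chosen subgradient of $f$ at $x$, and assume $\|\nabla f(x)\|\le G$ for all $x\in\mathcal X$, where $G>0$. Let $\mathbb D$ be a probability distribution on a space $\Xi$ and $g:\mathcal X\times\Xi\to\mathbb R^d$ a measurable map such that, with $\xi\sim\mathbb D$, for some $p\in(1,2]$ and all $x\in\mathcal X$ and all unit vectors $e\in\mathbb R^d$, $$\mathbb E[g(x,\xi)]=\nabla f(x),\qquad \mathbb E\big[|\langle e,g(x,\xi)-\nabla f(x)\rangle|^p\big]\le\sigma_s^p,\qquad \mathbb E\big[\|g(x,\xi)-\nabla f(x)\|^p\big]\le\sigma_l^p,$$ where $0\le\sigma_s\le\sigma_l\le\sqrt{\pi d/2}\,\sigma_s$. **Algorithm (proximal Clipped SGD).** Let $x_1\in\mathcal X$ with $D:=\|x_\star-x_1\|>0$. For a stepsize $\eta>0$ and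 a clipping threshold $\tau>0$ put, for $t=1,\dots,T$, $$g_t^c=\min\Big\{1,\frac{\tau}{\|g_t\|}\Big\}g_t,\quad g_t=g(x_t,\xi_t),\qquad x_{t+1}=\operatorname*{argmin}_{x\in\mathcal X}\; r(x)+\langle g_t^c,x\rangle+\frac{\|x-x_t\|^2}{2\eta},$$ where $\xi_1,\dots,\xi_T$ are independent with distribution $\mathbb D$, and let $\bar x_{T+1}=\frac1T\sum_{t=1}^T x_{t+1}$. **Parameters.** For $\delta\in(0,1]$ and an integer $T\ge1$ let $d_{\rm eff}=\sigma_l^2/\sigma_s^2$ (with $0/0=0$), $$\tau_\star=\Big(\min\Big\{\frac{\sigma_s\sigma_l^{p-1}}{\ln\frac3\delta},\frac{\sigma_s^2}{\sigma_l^{2-p}\mathbf 1[p<2]}\Big\}\Big)^{1/p},\qquad \varphi_\star=\max\Big\{\sqrt{d_{\rm eff}}\,\ln\tfrac3\delta,\;d_{\rm eff}\mathbf 1[p<2]\Big\},$$ (the second entry in the definition of $\tau_\star$ is $+\infty$ if $p=2$, and $\tau_\star=0$ if $\sigma_l=0$), $$\varphi=\inf_{\beta\in[0,1/2]}\big(\tfrac12\big)^{\beta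 p}\varphi_\star^{1-\beta}\Big(\frac{\sigma_l}{G}\Big)^{\beta p}T^\beta,\qquad A=\sigma_s^{\frac2p-1}\sigma_l^{2-\frac2p}+\sigma_s^{\frac1p}\sigma_l^{1-\frac1p}\ln^{1-\frac1p}\tfrac3\delta,$$ $$\eta_\star=\min\Big\{\frac{D/G}{\varphi+\ln\frac3\delta},\;\frac{D/G}{\sqrt{(\sigma_l^p/G^p+1)T}},\;\frac{D}{A\,T^{1/p}}\Big\}$$ (the last entry is $+\infty$ if $\sigma_l=0$). **Theorem.** There is an absolute constant $C>0$ such that in every such situation the following holds. 1. $\varphi\le\varphi_\star$, and $\varphi=\varphi_\star$ whenever $T\ge 2^p\,\frac{G^p}{\sigma_l^p}\,\varphi_\star$ (in the noiseless case $\sigma_l=0$, both are $0$). 2. If proximal Clipped SGD is run with the constant stepsize $\eta=\eta_\star$ and the constant threshold $\tau=\max\{2G,\tau_\star T^{1/p}\}$, then with probability at least $1-\delta$ $$F(\bar x_{T+1})-F_\star\le C\left(\frac{(\varphi+\ln\frac3\delta)GD}{T}+\frac{(\sigma_l^{p/2}G^{1-p/2}+G)D}{\sqrt T}+\frac{A\,D}{T^{1-1/p}}\right).$$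 3. If $\sigma_l>0$, the coefficient $A$ of the dominant term is $$A=\sigma_l\Big(d_{\rm eff}^{-\frac{2-p}{2p}}+d_{\rm eff}^{-\frac1{2p}}\ln^{1-\frac1p}\tfrac3\delta\Big).$$ -/

import Mathlib

open MeasureTheory ProbabilityTheory

noncomputable section

namespace ClippedSGD

/-- `v` is a subgradient at `x` of the function `f` on `ℝ^d`, i.e. `v ∈ ∂f(x)`. -/
def IsSubgradientAt {d : ℕ} (f : EuclideanSpace ℝ (Fin d) → ℝ)
    (x v : EuclideanSpace ℝ (Fin d)) : Prop :=
  ∀ y, f x + inner ℝ v (y - x) ≤ f y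

/-- The refined heavy-tailed noise condition on a stochastic first-order oracle `g` with sample
distribution `μ`: on `X` it is unbiased for the subgradient selection `gradf`, and its error has a
`p`-th moment at most `σs ^ p` along every unit direction and at most `σl ^ p` in norm. -/
structure RefinedNoise {d : ℕ} {Ξ : Type*} [MeasurableSpace Ξ]
    (X : Set (EuclideanSpace ℝ (Fin d)))
    (gradf : EuclideanSpace ℝ (Fin d) → EuclideanSpace ℝ (Fin d))
    (g : EuclideanSpace ℝ (Fin d) → Ξ → EuclideanSpace ℝ (Fin d))
    (μ : Measure Ξ) (p σs σl : ℝ) : Prop where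
  measurable_oracle : Measurable fun z : X × Ξ => g z.1 z.2
  integrable : ∀ x ∈ X, Integrable (g x) μ
  unbiased : ∀ x ∈ X, ∫ ξ, g x ξ ∂μ = gradf x
  integrable_norm : ∀ x ∈ X, Integrable (fun ξ => ‖g x ξ - gradf x‖ ^ p) μ
  moment_norm : ∀ x ∈ X, ∫ ξ, ‖g x ξ - gradf x‖ ^ p ∂μ ≤ σl ^ p
  moment_dir : ∀ x ∈ X, ∀ e : EuclideanSpace ℝ (Fin d), ‖e‖ = 1 →
    ∫ ξ, |inner ℝ e (g x ξ - gradf x)| ^ p ∂μ ≤ σs ^ p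
  σs_nonneg : 0 ≤ σs
  σs_le_σl : σs ≤ σl
  σl_le : σl ≤ √(Real.pi * d / 2) * σs

/-- The clipping operator `clip_τ(v) = min {1, τ / ‖v‖} v`. -/
def clip {d : ℕ} (τ : ℝ) (v : EuclideanSpace ℝ (Fin d)) : EuclideanSpace ℝ (Fin d) :=
  min 1 (τ / ‖v‖) • v

/-- The objective of the proximal step, `z ↦ r(z) + ⟨v, z⟩ + ‖z - x‖² / (2η)`. -/
def proxObj {d : ℕ} (r : EuclideanSpace ℝ (Fin d) → ℝ) (η : ℝ)
    (v x z : EuclideanSpace ℝ (Fin d)) : ℝ :=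
  r z + inner ℝ v z + ‖z - x‖ ^ 2 / (2 * η)

/-- The proximal step `argmin_{z ∈ X} r(z) + ⟨v, z⟩ + ‖z - x‖² / (2η)`. The minimizer exists and is
unique in the relevant situation, see `proxStep_mem`, `isMinOn_proxStep` and
`eq_proxStep_of_isMinOn`. -/
def proxStep {d : ℕ} (X : Set (EuclideanSpace ℝ (Fin d))) (r : EuclideanSpace ℝ (Fin d) → ℝ)
    (η : ℝ) (v x : EuclideanSpace ℝ (Fin d)) : EuclideanSpace ℝ (Fin d) :=
  Classical.epsilon fun y => y ∈ X ∧ IsMinOn (proxObj r η v x) X y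

/-- The iterates of (proximal) Clipped SGD with stepsizes `η t` and clipping thresholds `τ t`, run
on the samples `s 1, s 2, …`. With the iterates numbered `x_1, x_2, …`, `iterate … t` is `x_{t+1}`;
in particular `iterate … 0` is the initial point `x_1 = x₁`. -/
def iterate {d : ℕ} {Ξ : Type*} (X : Set (EuclideanSpace ℝ (Fin d)))
    (r : EuclideanSpace ℝ (Fin d) → ℝ)
    (g : EuclideanSpace ℝ (Fin d) → Ξ → EuclideanSpace ℝ (Fin d))
    (η τ : ℕ → ℝ) (x₁ : EuclideanSpace ℝ (Fin d)) (s : ℕ → Ξ) : ℕ → EuclideanSpace ℝ (Fin d)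
  | 0 => x₁
  | t + 1 =>
    proxStep X r (η (t + 1))
      (clip (τ (t + 1)) (g (iterate X r g η τ x₁ s t) (s (t + 1))))
      (iterate X r g η τ x₁ s t)

/-- The averaged iterate `(1/T) ∑_{t=1}^T x_{t+1}`. -/
def avgIterate {d : ℕ} {Ξ : Type*} (X : Set (EuclideanSpace ℝ (Fin d)))
    (r : EuclideanSpace ℝ (Fin d) → ℝ)
    (g : EuclideanSpace ℝ (Fin d) → Ξ → EuclideanSpace ℝ (Fin d))
    (η τ : ℕ → ℝ) (x₁ : EuclideanSpace ℝ (Fin d)) (s : ℕ → Ξ) (T : ℕ) :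
    EuclideanSpace ℝ (Fin d) :=
  (1 / (T : ℝ)) • ∑ t ∈ Finset.Icc 1 T, iterate X r g η τ x₁ s t

/-- The generalized effective dimension `d_eff = σl² / σs²`, with `0 / 0 = 0`. -/
def dEff (σs σl : ℝ) : ℝ := σl ^ 2 / σs ^ 2

/-- `τ⋆ = (min {σs σl^(p-1) / ln(3/δ), σs² / (σl^(2-p) 1[p<2])})^(1/p)`, where the second entry of
the minimum is `+∞` if `p = 2`, and where `0 / 0 = 0` in the noiseless case with `p < 2`. -/
def tauStar (p σs σl δ : ℝ) : ℝ :=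
  (if p < 2 then
    min (σs * σl ^ (p - 1) / Real.log (3 / δ)) (σs ^ 2 / σl ^ (2 - p))
  else σs * σl ^ (p - 1) / Real.log (3 / δ)) ^ (1 / p)

/-- `φ⋆ = max {√d_eff ln(3/δ), d_eff 1[p<2]}`. -/
def phiStar (p σs σl δ : ℝ) : ℝ :=
  max (√(dEff σs σl) * Real.log (3 / δ)) (dEff σs σl * if p < 2 then 1 else 0)

/-- `φ = inf_{β ∈ [0, 1/2]} (1-α)^(βp) φ⋆^(1-β) (σl/G)^(βp) T^β` with `α = 1/2`. -/
def phi (p σs σl G δ : ℝ) (T : ℕ) : ℝ :=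
  ⨅ β : Set.Icc (0 : ℝ) (1 / 2),
    (1 - 1 / 2 : ℝ) ^ ((β : ℝ) * p) * phiStar p σs σl δ ^ (1 - (β : ℝ)) *
      (σl / G) ^ ((β : ℝ) * p) * (T : ℝ) ^ (β : ℝ)

/-- The coefficient
`σs^(2/p-1) σl^(2-2/p) + σs^(1/p) σl^(1-1/p) ln^(1-1/p)(3/δ)` of `D / T^(1-1/p)`. -/
def domCoeff (p σs σl δ : ℝ) : ℝ :=
  σs ^ (2 / p - 1) * σl ^ (2 - 2 / p) +
    σs ^ (1 / p) * σl ^ (1 - 1 / p) * Real.log (3 / δ) ^ (1 - 1 / p)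

/-- The stepsize `η⋆`, a minimum of three quantities. In the noiseless case `σl = 0` the last one
has denominator `0`, is read as `+∞`, and drops out of the minimum. -/
def etaStar (p σs σl G D δ : ℝ) (T : ℕ) : ℝ :=
  let a := D / G / (phi p σs σl G δ T + Real.log (3 / δ))
  let b := D / G / √((σl ^ p / G ^ p + 1) * T)
  if σl = 0 then min a b
  else min (min a b) (D / (domCoeff p σs σl δ * (T : ℝ) ^ (1 / p)))

/-- The constant clipping threshold `max {G / (1 - α), τ⋆ T^(1/p)}` with `α = 1/2`. -/
def threshold (p σs σl G δ : ℝ) (T : ℕ) : ℝ :=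
  max (G / (1 - 1 / 2)) (tauStar p σs σl δ * (T : ℝ) ^ (1 / p))

/-- The convergence rate, without the absolute constant. -/
def rate (p σs σl G D δ : ℝ) (T : ℕ) : ℝ :=
  (phi p σs σl G δ T + Real.log (3 / δ)) * G * D / T +
    (σl ^ (p / 2) * G ^ (1 - p / 2) + G) * D / √T +
    domCoeff p σs σl δ * D / (T : ℝ) ^ (1 - 1 / p)

/-! Well-definedness of the proximal step. -/

theorem exists_proxObj_min {d : ℕ} {X : Set (EuclideanSpace ℝ (Fin d))}
    {r : EuclideanSpace ℝ (Fin d) → ℝ} {η : ℝ} {v x : EuclideanSpace ℝ (Fin d)}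
    (hX : IsClosed X) (hr : ConvexOn ℝ Set.univ r) (hη : 0 < η) (hx : x ∈ X) :
    ∃ y, y ∈ X ∧ IsMinOn (proxObj r η v x) X y := by
  have hrc : Continuous r := by
    rw [← continuousOn_univ]
    exact hr.continuousOn isOpen_univ
  have hφc : Continuous fun z => r z + inner ℝ v z := by fun_prop
  have hhc : Continuous (proxObj r η v x) := by
    unfold proxObj
    fun_prop
  obtain ⟨m, -, hm⟩ := (isCompact_closedBall x (1 : ℝ)).exists_isMinOn
    ⟨x, by simp⟩ hφc.continuousOn
  set K := (r x + inner ℝ v x) - (r m + inner ℝ v m) with hK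
  set R := max 1 (2 * η * K) with hR
  have hR1 : 1 ≤ R := le_max_left _ _
  obtain ⟨y, hy, hmin⟩ := ((isCompact_closedBall x R).inter_left hX).exists_isMinOn
    ⟨x, hx, by simp; linarith⟩ hhc.continuousOn
  refine ⟨y, hy.1, fun z hz => ?_⟩
  by_cases hzR : ‖z - x‖ ≤ R
  · exact hmin ⟨hz, by simpa [dist_eq_norm] using hzR⟩
  · push Not at hzR
    have hyx : proxObj r η v x y ≤ proxObj r η v x x := hmin ⟨hx, by simp; linarith⟩
    refine le_trans hyx ?_
    set N := ‖z - x‖ with hN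
    have hN1 : 1 < N := lt_of_le_of_lt hR1 hzR
    have hN0 : 0 < N := by linarith
    have hNi : N⁻¹ ≤ 1 := inv_le_one_of_one_le₀ hN1.le
    have hNi0 : 0 < N⁻¹ := inv_pos.2 hN0
    have h1 := hr.2 (Set.mem_univ x) (Set.mem_univ z) (sub_nonneg.2 hNi) hNi0.le (by ring)
    have h2 := hm (a := (1 - N⁻¹) • x + N⁻¹ • z) (by
      rw [Metric.mem_closedBall, dist_eq_norm]
      have : (1 - N⁻¹) • x + N⁻¹ • z - x = N⁻¹ • (z - x) := by module
      rw [this, norm_smul, Real.norm_of_nonneg hNi0.le, ← hN, inv_mul_cancel₀ hN0.ne'])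
    simp only [Set.mem_ofPred_eq, inner_add_right, inner_smul_right, smul_eq_mul] at h1 h2
    have h3 : r m + inner ℝ v m
        ≤ (1 - N⁻¹) * (r x + inner ℝ v x) + N⁻¹ * (r z + inner ℝ v z) := by linarith
    have h4 : N * (r m + inner ℝ v m)
        ≤ (N - 1) * (r x + inner ℝ v x) + (r z + inner ℝ v z) := by
      have := mul_le_mul_of_nonneg_left h3 hN0.le
      have e : N * N⁻¹ = 1 := mul_inv_cancel₀ hN0.ne'
      calc _ ≤ _ := this
        _ = (N - N * N⁻¹) * (r x + inner ℝ v x) + N * N⁻¹ * (r z + inner ℝ v z) := by ring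
        _ = _ := by rw [e]; ring
    have h5 : N * K ≤ N ^ 2 / (2 * η) := by
      rw [le_div_iff₀ (by positivity)]
      have : 2 * η * K ≤ N := (le_max_right _ _).trans hzR.le
      nlinarith
    simp only [proxObj, sub_self, norm_zero, ← hN]
    have h6 : N * K = N * (r x + inner ℝ v x) - N * (r m + inner ℝ v m) := by rw [hK]; ring
    norm_num
    linarith

theorem proxStep_mem {d : ℕ} {X : Set (EuclideanSpace ℝ (Fin d))}
    {r : EuclideanSpace ℝ (Fin d) → ℝ} {η : ℝ} {v x : EuclideanSpace ℝ (Fin d)}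
    (hX : IsClosed X) (hr : ConvexOn ℝ Set.univ r) (hη : 0 < η) (hx : x ∈ X) :
    proxStep X r η v x ∈ X :=
  (Classical.epsilon_spec (exists_proxObj_min (v := v) hX hr hη hx)).1

theorem isMinOn_proxStep {d : ℕ} {X : Set (EuclideanSpace ℝ (Fin d))}
    {r : EuclideanSpace ℝ (Fin d) → ℝ} {η : ℝ} {v x : EuclideanSpace ℝ (Fin d)}
    (hX : IsClosed X) (hr : ConvexOn ℝ Set.univ r) (hη : 0 < η) (hx : x ∈ X) :
    IsMinOn (proxObj r η v x) X (proxStep X r η v x) :=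
  (Classical.epsilon_spec (exists_proxObj_min (v := v) hX hr hη hx)).2

theorem eq_proxStep_of_isMinOn {d : ℕ} {X : Set (EuclideanSpace ℝ (Fin d))}
    {r : EuclideanSpace ℝ (Fin d) → ℝ} {η : ℝ} {v x y : EuclideanSpace ℝ (Fin d)}
    (hX : IsClosed X) (hXc : Convex ℝ X) (hr : ConvexOn ℝ Set.univ r) (hη : 0 < η) (hx : x ∈ X)
    (hy : y ∈ X) (hmin : IsMinOn (proxObj r η v x) X y) : y = proxStep X r η v x := by
  set w := proxStep X r η v x with hw
  have hwX : w ∈ X := proxStep_mem hX hr hη hx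
  have hwm : IsMinOn (proxObj r η v x) X w := isMinOn_proxStep hX hr hη hx
  have hmid : (1 / 2 : ℝ) • y + (1 / 2 : ℝ) • w ∈ X :=
    hXc hy hwX (by norm_num) (by norm_num) (by norm_num)
  have a1 : proxObj r η v x y ≤ _ := hmin hmid
  have a2 : proxObj r η v x w ≤ _ := hwm hmid
  have a3 := hr.2 (Set.mem_univ y) (Set.mem_univ w) (by norm_num : (0 : ℝ) ≤ 1 / 2)
    (by norm_num : (0 : ℝ) ≤ 1 / 2) (by norm_num)
  have a4 : ‖(1 / 2 : ℝ) • y + (1 / 2 : ℝ) • w - x‖ ^ 2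
      = ‖y - x‖ ^ 2 / 2 + ‖w - x‖ ^ 2 / 2 - ‖y - w‖ ^ 2 / 4 := by
    have e1 : (1 / 2 : ℝ) • y + (1 / 2 : ℝ) • w - x
        = (1 / 2 : ℝ) • ((y - x) + (w - x)) := by module
    have e2 : y - w = (y - x) - (w - x) := by abel
    have e3 := parallelogram_law_with_norm ℝ (y - x) (w - x)
    rw [← e2] at e3
    rw [e1, norm_smul, mul_pow]
    norm_num
    linarith
  simp only [proxObj, inner_add_right, inner_smul_right, smul_eq_mul] at a1 a2 a3
  rw [a4] at a1 a2
  have a5 : ‖y - w‖ ^ 2 / 4 / (2 * η) ≤ 0 := by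
    simp only [sub_div, add_div] at a1 a2 ⊢
    have s1 : ‖y - x‖ ^ 2 / 2 / (2 * η) = (‖y - x‖ ^ 2 / (2 * η)) / 2 := by ring
    have s2 : ‖w - x‖ ^ 2 / 2 / (2 * η) = (‖w - x‖ ^ 2 / (2 * η)) / 2 := by ring
    rw [s1, s2] at a1 a2
    linarith
  have a6 : ‖y - w‖ ^ 2 ≤ 0 := by
    by_contra h
    push Not at h
    have : 0 < ‖y - w‖ ^ 2 / 4 / (2 * η) := by positivity
    linarith
  have a7 : ‖y - w‖ = 0 := by
    have := sq_nonneg ‖y - w‖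
    exact pow_eq_zero_iff (two_ne_zero) |>.1 (le_antisymm a6 this)
  exact sub_eq_zero.1 (norm_eq_zero.1 a7)

end ClippedSGD

end

namespace ClippedSGD

/-! Write `ε_t` for the error of the clipped oracle at `x_t`. A proximal step obeys a descent
inequality in which the only random contribution is `⟨ε_t, x⋆ - x_t⟩ + η‖ε_t‖²`; the rest telescopes
or costs at most `4ηG²` per step (`objective_proxStep_sub_le`). It remains to bound the sum of these
error terms with high probability.

Since `τ ≥ 2G`, a sample is clipped only if its noise exceeds `τ/2`. Up to constants, the bias along
a unit direction is therefore at most `σs (σl/τ)^(p-1) + G (σl/τ)^p`, and the second moment along it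
at most `σs^p τ^(2-p) + G² (σl/τ)^p`; for the norm, `σs^p` is replaced by `σl^p`. The inner product
only sees the direction `x⋆ - x_t`, so only the directional variance gets multiplied by `ln(3/δ)`,
while the norm variance enters through the mean of `η‖ε_t‖²`. This separation produces the effective
dimension.

A Bernstein-type exponential moment (`RefinedNoise.integral_exp_le`) requires `‖x⋆ - x_t‖ ≤ R`,
which is not known in advance. The process is therefore stopped when it leaves the ball of radius `R
= 37D`; the exponential supermartingale bound and Markov's inequality apply to the stopped process
(`measure_lt_foldSamples_le`). On the resulting good event stopping never takes place: as optimality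
gaps are nonnegative, the summed descent inequality itself keeps the iterates in the ball
(`sum_objective_le_of_stopped`).

All parameters are measured by `h = D/η⋆`, the largest of the reciprocal entries of `η⋆`. The total
bias is `O(h)`, the total norm variance `O(h²)` and the total directional variance `O(h²/ln(3/δ))`
(`bounds_of_params`). The total gap is then `O(Dh)`, and division by `T` gives the rate. -/

/-! ### The proximal step -/

theorem proxStep_three_point {d : ℕ} {X : Set (EuclideanSpace ℝ (Fin d))}
    {r : EuclideanSpace ℝ (Fin d) → ℝ} {η : ℝ} {v x z : EuclideanSpace ℝ (Fin d)}
    (hX : IsClosed X) (hXc : Convex ℝ X) (hr : ConvexOn ℝ Set.univ r) (hη : 0 < η) (hx : x ∈ X)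
    (hz : z ∈ X) :
    proxObj r η v x (proxStep X r η v x) + ‖z - proxStep X r η v x‖ ^ 2 / (2 * η)
      ≤ proxObj r η v x z := by
  set w := proxStep X r η v x with hw
  have hwX : w ∈ X := proxStep_mem hX hr hη hx
  have hwm : IsMinOn (proxObj r η v x) X w := isMinOn_proxStep hX hr hη hx
  -- Minimality of `w` is tested on the segment towards `z`. The quadratic term leaves a surplus
  -- `θ(1 - θ)‖z - w‖²`; dividing by `θ` and letting `θ → 0` gives the claim without differentiating
  -- `r`.
  have key : ∀ θ : ℝ, 0 < θ → θ < 1 →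
      proxObj r η v x w + (1 - θ) * (‖z - w‖ ^ 2 / (2 * η)) ≤ proxObj r η v x z := by
    intro θ h0 h1
    have a1 : proxObj r η v x w ≤ proxObj r η v x ((1 - θ) • w + θ • z) :=
      hwm (hXc hwX hz (by linarith) h0.le (by ring))
    have a3 := hr.2 (Set.mem_univ w) (Set.mem_univ z) (by linarith : (0 : ℝ) ≤ 1 - θ)
      h0.le (by ring)
    have a4 : ‖(1 - θ) • w + θ • z - x‖ ^ 2
        = (1 - θ) * ‖w - x‖ ^ 2 + θ * ‖z - x‖ ^ 2 - θ * (1 - θ) * ‖z - w‖ ^ 2 := by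
      have e1 : (1 - θ) • w + θ • z - x = (1 - θ) • (w - x) + θ • (z - x) := by module
      have e2 : z - w = (z - x) - (w - x) := by abel
      rw [e1, e2]
      generalize w - x = a
      generalize z - x = b
      rw [norm_add_sq_real, norm_sub_sq_real, norm_smul, norm_smul, mul_pow, mul_pow,
        Real.norm_eq_abs, Real.norm_eq_abs, sq_abs, sq_abs, inner_smul_left, inner_smul_right,
        real_inner_comm a b]
      simp only [conj_trivial]
      ring
    simp only [proxObj, inner_add_right, inner_smul_right, smul_eq_mul] at a1 a3 ⊢
    rw [a4] at a1
    have s1 : ((1 - θ) * ‖w - x‖ ^ 2 + θ * ‖z - x‖ ^ 2 - θ * (1 - θ) * ‖z - w‖ ^ 2) / (2 * η)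
      = (1 - θ) * (‖w - x‖ ^ 2 / (2 * η)) + θ * (‖z - x‖ ^ 2 / (2 * η))
        - θ * ((1 - θ) * (‖z - w‖ ^ 2 / (2 * η))) := by ring
    rw [s1] at a1
    have := le_of_mul_le_mul_left (a := θ)
      (b := r w + inner ℝ v w + ‖w - x‖ ^ 2 / (2 * η) + (1 - θ) * (‖z - w‖ ^ 2 / (2 * η)))
      (c := r z + inner ℝ v z + ‖z - x‖ ^ 2 / (2 * η)) (by linarith) h0
    exact this
  have hlim : Filter.Tendsto
      (fun θ : ℝ => proxObj r η v x w + (1 - θ) * (‖z - w‖ ^ 2 / (2 * η)))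
      (nhdsWithin 0 (Set.Ioi 0)) (nhds (proxObj r η v x w + (1 - 0) * (‖z - w‖ ^ 2 / (2 * η)))) :=
    (Continuous.tendsto (by fun_prop) 0).mono_left nhdsWithin_le_nhds
  have := le_of_tendsto hlim (by
    filter_upwards [Ioo_mem_nhdsGT (zero_lt_one' ℝ)] with θ hθ using key θ hθ.1 hθ.2)
  simpa using this

/-- The three-point inequalities at the two inputs, each tested at the other output, add up to `‖w -
w'‖² ≤ ⟨(x - x') - η(v - v'), w - w'⟩`. The resulting continuity is needed because `proxStep` is
defined by choice, and the iterates have to be measurable in the samples. -/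
theorem norm_proxStep_sub_le {d : ℕ} {X : Set (EuclideanSpace ℝ (Fin d))}
    {r : EuclideanSpace ℝ (Fin d) → ℝ} {η : ℝ} {v v' x x' : EuclideanSpace ℝ (Fin d)}
    (hX : IsClosed X) (hXc : Convex ℝ X) (hr : ConvexOn ℝ Set.univ r) (hη : 0 < η) (hx : x ∈ X)
    (hx' : x' ∈ X) :
    ‖proxStep X r η v x - proxStep X r η v' x'‖ ≤ ‖x - x'‖ + η * ‖v - v'‖ := by
  have h1 := proxStep_three_point (v := v) hX hXc hr hη hx
    (proxStep_mem (v := v') hX hr hη hx')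
  have h2 := proxStep_three_point (v := v') hX hXc hr hη hx'
    (proxStep_mem (v := v) hX hr hη hx)
  set w := proxStep X r η v x
  set w' := proxStep X r η v' x'
  have h3 : ‖w - w'‖ ^ 2 ≤ inner ℝ ((x - x') - η • (v - v')) (w - w') := by
    simp only [proxObj] at h1 h2
    have h4 := add_le_add h1 h2
    have h5 : inner ℝ v w + inner ℝ v' w' - inner ℝ v w' - inner ℝ v' w
        + (‖w - x‖ ^ 2 + ‖w' - x'‖ ^ 2 - ‖w' - x‖ ^ 2 - ‖w - x'‖ ^ 2
          + ‖w' - w‖ ^ 2 + ‖w - w'‖ ^ 2) / (2 * η) ≤ 0 := by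
      simp only [add_div, sub_div]
      linarith
    have h6 := mul_le_mul_of_nonneg_left h5 hη.le
    rw [mul_add, mul_zero, show ∀ a : ℝ, η * (a / (2 * η)) = a / 2 by intro a; field_simp] at h6
    simp only [norm_sub_sq_real, inner_sub_left, inner_sub_right, inner_smul_left, conj_trivial]
      at h6 ⊢
    linarith [real_inner_comm w x, real_inner_comm w' x', real_inner_comm w' x,
      real_inner_comm w x', real_inner_comm w w']
  have h4 := h3.trans (real_inner_le_norm _ _)
  have h5 : ‖(x - x') - η • (v - v')‖ ≤ ‖x - x'‖ + η * ‖v - v'‖ := by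
    refine (norm_sub_le _ _).trans ?_
    rw [norm_smul, Real.norm_of_nonneg hη.le]
  by_contra! hlt
  have h6 : 0 < ‖w - w'‖ := lt_of_le_of_lt (by positivity) hlt
  nlinarith

theorem continuous_proxStep {d : ℕ} {X : Set (EuclideanSpace ℝ (Fin d))}
    {r : EuclideanSpace ℝ (Fin d) → ℝ} {η : ℝ}
    (hX : IsClosed X) (hXc : Convex ℝ X) (hr : ConvexOn ℝ Set.univ r) (hη : 0 < η) :
    Continuous fun z : EuclideanSpace ℝ (Fin d) × X => proxStep X r η z.1 z.2 := by
  rw [continuous_iff_continuousAt]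
  intro z₀
  rw [ContinuousAt, tendsto_iff_norm_sub_tendsto_zero]
  refine squeeze_zero (fun _ => norm_nonneg _)
    (fun z => norm_proxStep_sub_le hX hXc hr hη z.2.2 z₀.2.2) ?_
  have : Continuous fun z : EuclideanSpace ℝ (Fin d) × X =>
      ‖(z.2 : EuclideanSpace ℝ (Fin d)) - z₀.2‖ + η * ‖z.1 - z₀.1‖ := by fun_prop
  simpa using this.tendsto z₀

/-- The one-step inequality of proximal subgradient descent with the inexact subgradient `v`. -/
theorem objective_proxStep_sub_le {d : ℕ} {X : Set (EuclideanSpace ℝ (Fin d))}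
    {f r : EuclideanSpace ℝ (Fin d) → ℝ} {η G : ℝ} {v x z : EuclideanSpace ℝ (Fin d)}
    {gradf : EuclideanSpace ℝ (Fin d) → EuclideanSpace ℝ (Fin d)}
    (hX : IsClosed X) (hXc : Convex ℝ X) (hr : ConvexOn ℝ Set.univ r)
    (hsub : ∀ x ∈ X, IsSubgradientAt f x (gradf x)) (hG : ∀ x ∈ X, ‖gradf x‖ ≤ G)
    (hη : 0 < η) (hx : x ∈ X) (hz : z ∈ X) :
    (f (proxStep X r η v x) + r (proxStep X r η v x)) - (f z + r z)
      ≤ inner ℝ (v - gradf x) (z - x) + η * ‖v - gradf x‖ ^ 2 + 4 * η * G ^ 2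
        + (‖z - x‖ ^ 2 - ‖z - proxStep X r η v x‖ ^ 2) / (2 * η) := by
  have h1 := proxStep_three_point (v := v) hX hXc hr hη hx hz
  have hwX := proxStep_mem (v := v) hX hr hη hx
  set w := proxStep X r η v x
  have h2 := hsub x hx z
  have h3 := hsub w hwX x
  have h4 : inner ℝ (gradf w) (w - x) ≤ G * ‖w - x‖ :=
    (real_inner_le_norm _ _).trans (mul_le_mul_of_nonneg_right (hG w hwX) (norm_nonneg _))
  have h5 : inner ℝ (gradf x) (x - w) ≤ G * ‖w - x‖ := by
    rw [norm_sub_rev w x]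
    exact (real_inner_le_norm _ _).trans (mul_le_mul_of_nonneg_right (hG x hx) (norm_nonneg _))
  have h6 : inner ℝ (v - gradf x) (x - w) ≤ ‖v - gradf x‖ * ‖w - x‖ := by
    rw [norm_sub_rev w x]
    exact real_inner_le_norm _ _
  -- The quadratic proximal term absorbs the first-order loss. As `f` need not be smooth, the
  -- gradients at `x` and at `w` are each bounded by `G`, whence `2G`.
  have h7 : (‖v - gradf x‖ + 2 * G) * ‖w - x‖
      ≤ η * ‖v - gradf x‖ ^ 2 + 4 * η * G ^ 2 + ‖w - x‖ ^ 2 / (2 * η) := by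
    have e : η * ‖v - gradf x‖ ^ 2 + 4 * η * G ^ 2 + ‖w - x‖ ^ 2 / (2 * η)
        - (‖v - gradf x‖ + 2 * G) * ‖w - x‖
        = (η * (‖v - gradf x‖ - 2 * G) ^ 2) / 2 +
          (η * (‖v - gradf x‖ + 2 * G) - ‖w - x‖) ^ 2 / (2 * η) := by
      field_simp
      ring
    have : 0 ≤ (η * (‖v - gradf x‖ - 2 * G) ^ 2) / 2 +
          (η * (‖v - gradf x‖ + 2 * G) - ‖w - x‖) ^ 2 / (2 * η) := by positivity
    linarith
  simp only [proxObj] at h1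
  simp only [inner_sub_left, inner_sub_right] at h2 h3 h4 h5 h6 ⊢
  rw [sub_div]
  linarith

/-! ### Pointwise bounds on the clipping error -/

theorem clip_eq_self {d : ℕ} {τ : ℝ} {v : EuclideanSpace ℝ (Fin d)} (h : ‖v‖ ≤ τ) :
    clip τ v = v := by
  rcases eq_or_ne v 0 with rfl | hv
  · simp [clip]
  · rw [clip, min_eq_left ((one_le_div (norm_pos_iff.2 hv)).2 h), one_smul]

theorem norm_clip_le {d : ℕ} {τ : ℝ} (hτ : 0 ≤ τ) (v : EuclideanSpace ℝ (Fin d)) :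
    ‖clip τ v‖ ≤ τ := by
  rcases eq_or_ne v 0 with rfl | hv
  · simpa [clip]
  · rw [clip, norm_smul, Real.norm_of_nonneg (by positivity)]
    calc _ ≤ τ / ‖v‖ * ‖v‖ := by gcongr; exact min_le_right _ _
      _ = τ := div_mul_cancel₀ _ (norm_ne_zero_iff.2 hv)

theorem measurable_clip {d : ℕ} (τ : ℝ) :
    Measurable (clip τ : EuclideanSpace ℝ (Fin d) → EuclideanSpace ℝ (Fin d)) := by
  unfold clip
  fun_prop

theorem norm_clip_sub_le {d : ℕ} {τ : ℝ} (hτ : 0 ≤ τ) {y v : EuclideanSpace ℝ (Fin d)}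
    (hv : ‖v‖ ≤ τ / 2) : ‖clip τ y - v‖ ≤ 3 / 2 * τ :=
  (norm_sub_le _ _).trans (by linarith [norm_clip_le hτ y])

/-- Trades a `p`-th moment for a second moment: the missing power `2 - p` is paid with the bound
`b`, which after clipping is a multiple of `τ`. -/
theorem sq_le_rpow_mul_rpow {a b p : ℝ} (ha : 0 ≤ a) (hab : a ≤ b) (hp : p ≤ 2) :
    a ^ 2 ≤ a ^ p * b ^ (2 - p) := by
  rcases ha.eq_or_lt with rfl | ha'
  · have : 0 ≤ (0 : ℝ) ^ p * b ^ (2 - p) := by positivity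
    simpa using this
  · calc a ^ 2 = a ^ p * a ^ (2 - p) := by
          rw [← Real.rpow_add ha', add_sub_cancel, Real.rpow_two]
      _ ≤ _ := by gcongr

/-- A clipped sample has noise larger than `τ/2`, because its mean has norm at most `τ/2`. Hence the
indicator of clipping is at most any nonnegative power of `2b/τ`. -/
theorem one_le_two_mul_div {a b c τ : ℝ} (hτ : 0 < τ) (h : a ≤ c + b) (hc : c ≤ τ / 2)
    (ha : τ < a) : 1 ≤ 2 * b / τ := by
  rw [one_le_div hτ]
  linarith

/-- The clipping error in the direction of `w`, in terms of the noise `y - v`. -/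
theorem inner_clip_sub_sq_le {d : ℕ} {τ p : ℝ} (hτ : 0 < τ) (hp1 : 1 < p) (hp : p ≤ 2)
    {y v w : EuclideanSpace ℝ (Fin d)} (hv : ‖v‖ ≤ τ / 2) (hw : ‖w‖ = 1) :
    inner ℝ w (clip τ y - v) ^ 2 ≤ 2 * (|inner ℝ w (y - v)| ^ p * (3 / 2 * τ) ^ (2 - p))
      + 2 * ‖v‖ ^ 2 * (2 * ‖y - v‖ / τ) ^ p := by
  have hpos : 0 ≤ |inner ℝ w (y - v)| ^ p * (3 / 2 * τ) ^ (2 - p) := by positivity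
  have hpos2 : 0 ≤ 2 * ‖v‖ ^ 2 * (2 * ‖y - v‖ / τ) ^ p := by positivity
  have hwv : |inner ℝ w v| ≤ ‖v‖ := by simpa [hw] using abs_real_inner_le_norm w v
  rcases le_or_gt ‖y‖ τ with hy | hy
  · rw [clip_eq_self hy]
    have h1 : |inner ℝ w (y - v)| ≤ 3 / 2 * τ := by
      refine (abs_real_inner_le_norm _ _).trans ?_
      rw [hw, one_mul]
      exact (norm_sub_le _ _).trans (by linarith)
    have := sq_le_rpow_mul_rpow (abs_nonneg _) h1 hp
    rw [sq_abs] at this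
    linarith
  · have hy' : ‖y‖ ≤ ‖v‖ + ‖y - v‖ := by
      simpa using norm_add_le v (y - v)
    have h1 : 1 ≤ (2 * ‖y - v‖ / τ) ^ p :=
      Real.one_le_rpow (one_le_two_mul_div hτ hy' hv hy) (by linarith)
    have h2 := norm_clip_le hτ.le y
    set c := min 1 (τ / ‖y‖) with hc
    have hc0 : 0 ≤ c := by positivity
    have hc1 : c ≤ 1 := min_le_left _ _
    have hcy : clip τ y = c • y := rfl
    -- Clipping shrinks the noise by the factor `c` and adds the error `-(1 - c)v`, present only on
    -- the clipping event. The square is split between these two parts.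
    have e : inner ℝ w (clip τ y - v) = c * inner ℝ w (y - v) - (1 - c) * inner ℝ w v := by
      rw [hcy, inner_sub_right, inner_sub_right, inner_smul_right]
      ring
    have h3 : |c * inner ℝ w (y - v)| ≤ 3 / 2 * τ := by
      have : c * inner ℝ w (y - v) = inner ℝ w (clip τ y) - c * inner ℝ w v := by
        rw [hcy, inner_sub_right, inner_smul_right]
        ring
      rw [this]
      refine (abs_sub _ _).trans ?_
      have h4 : |inner ℝ w (clip τ y)| ≤ τ := by
        refine (abs_real_inner_le_norm _ _).trans ?_
        rwa [hw, one_mul]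
      have h5 : |c * inner ℝ w v| ≤ τ / 2 := by
        rw [abs_mul, abs_of_nonneg hc0]
        calc c * |inner ℝ w v| ≤ 1 * (τ / 2) := by gcongr; linarith
          _ = _ := one_mul _
      linarith
    have h4 := sq_le_rpow_mul_rpow (abs_nonneg _) h3 hp
    have h5 : |c * inner ℝ w (y - v)| ^ p ≤ |inner ℝ w (y - v)| ^ p := by
      refine Real.rpow_le_rpow (abs_nonneg _) ?_ (by linarith)
      rw [abs_mul, abs_of_nonneg hc0]
      exact mul_le_of_le_one_left (abs_nonneg _) hc1
    have h6 : |c * inner ℝ w (y - v)| ^ p * (3 / 2 * τ) ^ (2 - p)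
        ≤ |inner ℝ w (y - v)| ^ p * (3 / 2 * τ) ^ (2 - p) := by gcongr
    have h7 : ((1 - c) * inner ℝ w v) ^ 2 ≤ ‖v‖ ^ 2 * (2 * ‖y - v‖ / τ) ^ p := by
      rw [← sq_abs, abs_mul, abs_of_nonneg (by linarith : 0 ≤ 1 - c)]
      calc ((1 - c) * |inner ℝ w v|) ^ 2 ≤ (1 * ‖v‖) ^ 2 := by gcongr; linarith
        _ = ‖v‖ ^ 2 * 1 := by ring
        _ ≤ _ := by gcongr
    rw [sq_abs] at h4
    rw [e]
    nlinarith [sq_nonneg (c * inner ℝ w (y - v) + (1 - c) * inner ℝ w v)]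

/-- This is the directional bound along the clipping error itself. -/
theorem norm_clip_sub_sq_le {d : ℕ} {τ p : ℝ} (hτ : 0 < τ) (hp1 : 1 < p) (hp : p ≤ 2)
    {y v : EuclideanSpace ℝ (Fin d)} (hv : ‖v‖ ≤ τ / 2) :
    ‖clip τ y - v‖ ^ 2 ≤ 2 * (‖y - v‖ ^ p * (3 / 2 * τ) ^ (2 - p))
      + 2 * ‖v‖ ^ 2 * (2 * ‖y - v‖ / τ) ^ p := by
  set u := clip τ y - v with hu
  rcases eq_or_ne u 0 with h0 | h0
  · rw [h0, norm_zero]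
    have : 0 ≤ 2 * (‖y - v‖ ^ p * (3 / 2 * τ) ^ (2 - p))
      + 2 * ‖v‖ ^ 2 * (2 * ‖y - v‖ / τ) ^ p := by positivity
    simpa using this
  · have hn : ‖u‖ ≠ 0 := norm_ne_zero_iff.2 h0
    have hw : ‖(‖u‖⁻¹ • u)‖ = 1 := by rw [norm_smul, norm_inv, norm_norm, inv_mul_cancel₀ hn]
    have := inner_clip_sub_sq_le (y := y) hτ hp1 hp hv hw
    rw [← hu, real_inner_smul_left, real_inner_self_eq_norm_sq,
      show ‖u‖⁻¹ * ‖u‖ ^ 2 = ‖u‖ by field_simp] at this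
    refine this.trans ?_
    gcongr
    refine (abs_real_inner_le_norm _ _).trans ?_
    rw [hw, one_mul]

/-- The term `⟨w, y - v⟩` is kept exactly since its mean is zero. On the clipping event the
remaining noise term is weighted by only `p - 1` powers of `2‖y - v‖/τ`, so that one factor stays in
the direction `w` and the bias contains `σs` rather than `σl`. -/
theorem inner_clip_sub_le {d : ℕ} {τ p : ℝ} (hτ : 0 < τ) (hp1 : 1 < p)
    {y v w : EuclideanSpace ℝ (Fin d)} (hv : ‖v‖ ≤ τ / 2) (hw : ‖w‖ = 1) :
    inner ℝ w (clip τ y - v) ≤ inner ℝ w (y - v)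
      + (2 / τ) ^ (p - 1) * (‖y - v‖ ^ (p - 1) * |inner ℝ w (y - v)|)
      + ‖v‖ * (2 * ‖y - v‖ / τ) ^ p := by
  have hpos : 0 ≤ (2 / τ) ^ (p - 1) * (‖y - v‖ ^ (p - 1) * |inner ℝ w (y - v)|) := by positivity
  have hpos2 : 0 ≤ ‖v‖ * (2 * ‖y - v‖ / τ) ^ p := by positivity
  rcases le_or_gt ‖y‖ τ with hy | hy
  · rw [clip_eq_self hy]
    linarith
  · have hy' : ‖y‖ ≤ ‖v‖ + ‖y - v‖ := by
      simpa using norm_add_le v (y - v)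
    have h0 := one_le_two_mul_div hτ hy' hv hy
    have h1 : 1 ≤ (2 * ‖y - v‖ / τ) ^ p := Real.one_le_rpow h0 (by linarith)
    have h2 : 1 ≤ (2 / τ) ^ (p - 1) * ‖y - v‖ ^ (p - 1) := by
      rw [← Real.mul_rpow (by positivity) (by positivity), div_mul_eq_mul_div]
      exact Real.one_le_rpow h0 (by linarith)
    have hwv : |inner ℝ w v| ≤ ‖v‖ := by simpa [hw] using abs_real_inner_le_norm w v
    set c := min 1 (τ / ‖y‖) with hc
    have hc0 : 0 ≤ c := by positivity
    have hc1 : c ≤ 1 := min_le_left _ _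
    have hcy : clip τ y = c • y := rfl
    have e : inner ℝ w (clip τ y - v)
        = inner ℝ w (y - v) - (1 - c) * (inner ℝ w (y - v) + inner ℝ w v) := by
      rw [hcy, inner_sub_right, inner_sub_right, inner_smul_right]
      ring
    have h3 : |inner ℝ w (y - v)|
        ≤ (2 / τ) ^ (p - 1) * (‖y - v‖ ^ (p - 1) * |inner ℝ w (y - v)|) := by
      rw [← mul_assoc]
      exact le_mul_of_one_le_left (abs_nonneg _) h2
    have h4 : ‖v‖ ≤ ‖v‖ * (2 * ‖y - v‖ / τ) ^ p := le_mul_of_one_le_right (norm_nonneg _) h1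
    have h5 : -((1 - c) * (inner ℝ w (y - v) + inner ℝ w v))
        ≤ |inner ℝ w (y - v)| + |inner ℝ w v| := by
      refine (neg_le_abs _).trans ?_
      rw [abs_mul, abs_of_nonneg (by linarith : 0 ≤ 1 - c)]
      exact (mul_le_of_le_one_left (abs_nonneg _) (by linarith)).trans (abs_add_le _ _)
    rw [e]
    linarith

/-! ### Bias, variance and exponential moment of the clipped oracle -/

section Noise

variable {d : ℕ} {Ξ : Type*} [MeasurableSpace Ξ] {X : Set (EuclideanSpace ℝ (Fin d))}
  {gradf : EuclideanSpace ℝ (Fin d) → EuclideanSpace ℝ (Fin d)}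
  {g : EuclideanSpace ℝ (Fin d) → Ξ → EuclideanSpace ℝ (Fin d)}
  {μ : Measure Ξ} {p σs σl : ℝ}

theorem RefinedNoise.measurable_apply (h : RefinedNoise X gradf g μ p σs σl)
    {x : EuclideanSpace ℝ (Fin d)} (hx : x ∈ X) : Measurable (g x) :=
  h.measurable_oracle.comp (measurable_prodMk_left (x := (⟨x, hx⟩ : X)))

theorem RefinedNoise.σl_nonneg (h : RefinedNoise X gradf g μ p σs σl) : 0 ≤ σl :=
  h.σs_nonneg.trans h.σs_le_σl

theorem RefinedNoise.σs_pos (h : RefinedNoise X gradf g μ p σs σl) (hσ : 0 < σl) : 0 < σs := by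
  refine h.σs_nonneg.lt_of_ne fun h0 => ?_
  have := h.σl_le
  rw [← h0, mul_zero] at this
  linarith

theorem RefinedNoise.measurable_gradf [SFinite μ] (h : RefinedNoise X gradf g μ p σs σl) :
    Measurable fun x : X => gradf x := by
  have h1 : StronglyMeasurable fun x : X => ∫ ξ, g x ξ ∂μ :=
    h.measurable_oracle.stronglyMeasurable.integral_prod_right'
  have h2 : (fun x : X => gradf x) = fun x : X => ∫ ξ, g x ξ ∂μ :=
    funext fun x => (h.unbiased x x.2).symm
  rw [h2]
  exact h1.measurable

/-- The bound on the bias of the clipped oracle, along any direction. -/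
noncomputable def biasBound (p σs σl G τ : ℝ) : ℝ :=
  σs * (2 * σl / τ) ^ (p - 1) + G * (2 * σl / τ) ^ p

/-- The bound on the second moment of the error of the clipped oracle, when the noise has a `p`-th
moment at most `σ ^ p` along the directions in question. -/
noncomputable def varBound (p σ σl G τ : ℝ) : ℝ :=
  2 * (σ ^ p * (3 / 2 * τ) ^ (2 - p)) + 2 * G ^ 2 * (2 * σl / τ) ^ p

theorem RefinedNoise.integral_scaled_le (h : RefinedNoise X gradf g μ p σs σl) {τ : ℝ}
    (hτ : 0 < τ) {x : EuclideanSpace ℝ (Fin d)} (hx : x ∈ X) :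
    Integrable (fun ξ => (2 * ‖g x ξ - gradf x‖ / τ) ^ p) μ ∧
      ∫ ξ, (2 * ‖g x ξ - gradf x‖ / τ) ^ p ∂μ ≤ (2 * σl / τ) ^ p := by
  have e : ∀ a : ℝ, 0 ≤ a → (2 * a / τ) ^ p = (2 / τ) ^ p * a ^ p := fun a ha => by
    rw [← Real.mul_rpow (by positivity) ha, div_mul_eq_mul_div]
  simp only [e _ (norm_nonneg _), e _ h.σl_nonneg]
  refine ⟨(h.integrable_norm x hx).const_mul _, ?_⟩
  rw [integral_const_mul]
  exact mul_le_mul_of_nonneg_left (h.moment_norm x hx) (by positivity)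

theorem RefinedNoise.integrable_dir [IsFiniteMeasure μ] (h : RefinedNoise X gradf g μ p σs σl)
    (hp1 : 1 < p) {x : EuclideanSpace ℝ (Fin d)} (hx : x ∈ X)
    {w : EuclideanSpace ℝ (Fin d)} (hw : ‖w‖ = 1) :
    Integrable (fun ξ => |inner ℝ w (g x ξ - gradf x)| ^ p) μ := by
  have hm := h.measurable_apply hx
  refine (h.integrable_norm x hx).mono'
    ((by fun_prop : Measurable fun ξ => |inner ℝ w (g x ξ - gradf x)|).pow_const
      p).aestronglyMeasurable (ae_of_all _ fun ξ => ?_)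
  rw [Real.norm_of_nonneg (by positivity)]
  refine Real.rpow_le_rpow (abs_nonneg _) ?_ (by linarith)
  simpa [hw] using abs_real_inner_le_norm w (g x ξ - gradf x)

/-- Hölder's inequality with exponents `p/(p-1)` and `p`, obtained by integrating the weighted Young
inequality for the factors normalised by `σl` and `σs`. If `σl = 0`, normalisation is impossible but
both sides vanish. -/
theorem RefinedNoise.integral_cross_le [IsFiniteMeasure μ]
    (h : RefinedNoise X gradf g μ p σs σl) (hp1 : 1 < p) {x : EuclideanSpace ℝ (Fin d)}
    (hx : x ∈ X) {w : EuclideanSpace ℝ (Fin d)} (hw : ‖w‖ = 1) :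
    Integrable (fun ξ => ‖g x ξ - gradf x‖ ^ (p - 1) * |inner ℝ w (g x ξ - gradf x)|) μ ∧
      ∫ ξ, ‖g x ξ - gradf x‖ ^ (p - 1) * |inner ℝ w (g x ξ - gradf x)| ∂μ
        ≤ σl ^ (p - 1) * σs := by
  have hm := h.measurable_apply hx
  have hle : ∀ ξ, |inner ℝ w (g x ξ - gradf x)| ≤ ‖g x ξ - gradf x‖ := fun ξ => by
    simpa [hw] using abs_real_inner_le_norm w (g x ξ - gradf x)
  have hle' : ∀ ξ, ‖g x ξ - gradf x‖ ^ (p - 1) * |inner ℝ w (g x ξ - gradf x)|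
      ≤ ‖g x ξ - gradf x‖ ^ p := fun ξ => by
    calc _ ≤ ‖g x ξ - gradf x‖ ^ (p - 1) * ‖g x ξ - gradf x‖ := by gcongr; exact hle ξ
      _ = ‖g x ξ - gradf x‖ ^ p := by
        conv_lhs => rw [← Real.rpow_add_one' (norm_nonneg _) (by linarith)]
        rw [sub_add_cancel]
  have hint : Integrable
      (fun ξ => ‖g x ξ - gradf x‖ ^ (p - 1) * |inner ℝ w (g x ξ - gradf x)|) μ := by
    refine (h.integrable_norm x hx).mono' (by fun_prop) (ae_of_all _ fun ξ => ?_)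
    rw [Real.norm_of_nonneg (by positivity)]
    exact hle' ξ
  refine ⟨hint, ?_⟩
  rcases h.σl_nonneg.eq_or_lt with h0 | h0
  · refine (integral_mono hint (h.integrable_norm x hx) hle').trans
      ((h.moment_norm x hx).trans ?_)
    rw [← h0, Real.zero_rpow (by linarith), Real.zero_rpow (by linarith), zero_mul]
  · have hs := h.σs_pos h0
    have hp0 : 0 < p := by linarith
    have young : ∀ a b : ℝ, 0 ≤ a → 0 ≤ b → a ^ (p - 1) * b
        ≤ σl ^ (p - 1) * σs * ((1 - 1 / p) * (a ^ p / σl ^ p) + 1 / p * (b ^ p / σs ^ p)) := by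
      intro a b ha hb
      have hp' : 1 / p ≤ 1 := by rw [div_le_one hp0]; linarith
      have := Real.geom_mean_le_arith_mean2_weighted (sub_nonneg.2 hp')
        (by positivity : 0 ≤ 1 / p) (by positivity : 0 ≤ (a / σl) ^ p)
        (by positivity : 0 ≤ (b / σs) ^ p) (by ring)
      rw [← Real.rpow_mul (by positivity), ← Real.rpow_mul (by positivity), mul_one_div_cancel
        hp0.ne', Real.rpow_one, mul_one_sub, mul_one_div_cancel hp0.ne',
        Real.div_rpow ha h0.le, Real.div_rpow ha h0.le, Real.div_rpow hb hs.le] at this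
      calc a ^ (p - 1) * b = σl ^ (p - 1) * σs * (a ^ (p - 1) / σl ^ (p - 1) * (b / σs)) := by
            have : 0 < σl ^ (p - 1) := by positivity
            field_simp
        _ ≤ _ := by gcongr
    have hi1 := (h.integrable_norm x hx).div_const (σl ^ p)
    have hi2 := (h.integrable_dir hp1 hx hw).div_const (σs ^ p)
    refine (integral_mono hint ((((hi1.const_mul (1 - 1 / p)).add (hi2.const_mul (1 / p)))).const_mul
      (σl ^ (p - 1) * σs)) fun ξ => young _ _ (norm_nonneg _) (abs_nonneg _)).trans ?_
    rw [integral_const_mul]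
    refine mul_le_of_le_one_right (by positivity) ?_
    simp only [Pi.add_apply]
    rw [integral_add (hi1.const_mul _) (hi2.const_mul _), integral_const_mul, integral_const_mul,
      integral_div, integral_div]
    have h1 : (∫ ξ, ‖g x ξ - gradf x‖ ^ p ∂μ) / σl ^ p ≤ 1 :=
      (div_le_one (by positivity)).2 (h.moment_norm x hx)
    have h2 : (∫ ξ, |inner ℝ w (g x ξ - gradf x)| ^ p ∂μ) / σs ^ p ≤ 1 :=
      (div_le_one (by positivity)).2 (h.moment_dir x hx w hw)
    have hp' : 1 / p ≤ 1 := by rw [div_le_one hp0]; linarith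
    have := mul_le_mul_of_nonneg_left h1 (sub_nonneg.2 hp')
    have := mul_le_mul_of_nonneg_left h2 (by positivity : 0 ≤ 1 / p)
    linarith

variable {G τ : ℝ}

theorem RefinedNoise.integral_norm_clip_sub_sq_le (h : RefinedNoise X gradf g μ p σs σl)
    (hp1 : 1 < p) (hp : p ≤ 2) (hτ : 0 < τ) (hGτ : G ≤ τ / 2) {x : EuclideanSpace ℝ (Fin d)}
    (hx : x ∈ X) (hG : ‖gradf x‖ ≤ G) :
    ∫ ξ, ‖clip τ (g x ξ) - gradf x‖ ^ 2 ∂μ ≤ varBound p σl σl G τ := by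
  obtain ⟨i1, b1⟩ := h.integral_scaled_le hτ hx
  have i2 := (h.integrable_norm x hx).mul_const ((3 / 2 * τ) ^ (2 - p))
  refine (integral_mono_of_nonneg (ae_of_all _ fun ξ => sq_nonneg _)
    ((i2.const_mul 2).add (i1.const_mul (2 * ‖gradf x‖ ^ 2)))
    (ae_of_all _ fun ξ => norm_clip_sub_sq_le hτ hp1 hp (hG.trans hGτ))).trans ?_
  simp only [Pi.add_apply]
  rw [integral_add (i2.const_mul _) (i1.const_mul _), integral_const_mul, integral_const_mul,
    integral_mul_const, varBound]
  refine add_le_add (mul_le_mul_of_nonneg_left (mul_le_mul_of_nonneg_right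
    (h.moment_norm x hx) (by positivity)) zero_le_two) (mul_le_mul ?_ b1
    (integral_nonneg fun ξ => by positivity) (by positivity))
  gcongr

variable [IsProbabilityMeasure μ]

theorem RefinedNoise.integrable_clip_sub (h : RefinedNoise X gradf g μ p σs σl) (hτ : 0 < τ)
    {x : EuclideanSpace ℝ (Fin d)} (hx : x ∈ X) :
    Integrable (fun ξ => clip τ (g x ξ) - gradf x) μ := by
  refine Integrable.sub (Integrable.of_bound
    ((measurable_clip τ).comp (h.measurable_apply hx)).aestronglyMeasurable τ
    (ae_of_all _ fun ξ => norm_clip_le hτ.le _)) (integrable_const _)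

theorem RefinedNoise.integral_inner_clip_sub_le (h : RefinedNoise X gradf g μ p σs σl)
    (hp1 : 1 < p) (hτ : 0 < τ) (hGτ : G ≤ τ / 2) {x : EuclideanSpace ℝ (Fin d)} (hx : x ∈ X)
    (hG : ‖gradf x‖ ≤ G) {w : EuclideanSpace ℝ (Fin d)} (hw : ‖w‖ = 1) :
    ∫ ξ, inner ℝ w (clip τ (g x ξ) - gradf x) ∂μ ≤ biasBound p σs σl G τ := by
  obtain ⟨i1, b1⟩ := h.integral_scaled_le hτ hx
  obtain ⟨i2, b2⟩ := h.integral_cross_le hp1 hx hw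
  have i3 : Integrable (fun ξ => g x ξ - gradf x) μ :=
    (h.integrable x hx).sub (integrable_const _)
  have i4 : Integrable (fun ξ => inner ℝ w (g x ξ - gradf x)) μ := i3.const_inner w
  have b4 : ∫ ξ, inner ℝ w (g x ξ - gradf x) ∂μ = 0 := by
    rw [integral_inner i3, integral_sub (h.integrable x hx) (integrable_const _),
      h.unbiased x hx]
    simp
  refine (integral_mono ((h.integrable_clip_sub hτ hx).const_inner w)
    ((i4.add (i2.const_mul ((2 / τ) ^ (p - 1)))).add (i1.const_mul ‖gradf x‖))
    fun ξ => inner_clip_sub_le hτ hp1 (hG.trans hGτ) hw).trans ?_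
  rw [integral_add' (i4.add (i2.const_mul _)) (i1.const_mul _),
    integral_add' i4 (i2.const_mul _), b4, zero_add, integral_const_mul, integral_const_mul,
    biasBound]
  refine add_le_add ?_ ?_
  · calc _ ≤ (2 / τ) ^ (p - 1) * (σl ^ (p - 1) * σs) := by gcongr
      _ = _ := by
        rw [← mul_assoc, ← Real.mul_rpow (by positivity) h.σl_nonneg, div_mul_eq_mul_div, mul_comm]
  · have : 0 ≤ ∫ ξ, (2 * ‖g x ξ - gradf x‖ / τ) ^ p ∂μ :=
      integral_nonneg fun ξ => by positivity
    exact mul_le_mul hG b1 this ((norm_nonneg _).trans hG)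

theorem RefinedNoise.integral_inner_clip_sub_sq_le (h : RefinedNoise X gradf g μ p σs σl)
    (hp1 : 1 < p) (hp : p ≤ 2) (hτ : 0 < τ) (hGτ : G ≤ τ / 2) {x : EuclideanSpace ℝ (Fin d)}
    (hx : x ∈ X) (hG : ‖gradf x‖ ≤ G) {w : EuclideanSpace ℝ (Fin d)} (hw : ‖w‖ = 1) :
    ∫ ξ, inner ℝ w (clip τ (g x ξ) - gradf x) ^ 2 ∂μ ≤ varBound p σs σl G τ := by
  obtain ⟨i1, b1⟩ := h.integral_scaled_le hτ hx
  have i2 := (h.integrable_dir hp1 hx hw).mul_const ((3 / 2 * τ) ^ (2 - p))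
  refine (integral_mono_of_nonneg (ae_of_all _ fun ξ => sq_nonneg _)
    ((i2.const_mul 2).add (i1.const_mul (2 * ‖gradf x‖ ^ 2)))
    (ae_of_all _ fun ξ => inner_clip_sub_sq_le hτ hp1 hp (hG.trans hGτ) hw)).trans ?_
  simp only [Pi.add_apply]
  rw [integral_add (i2.const_mul _) (i1.const_mul _), integral_const_mul, integral_const_mul,
    integral_mul_const, varBound]
  refine add_le_add (mul_le_mul_of_nonneg_left (mul_le_mul_of_nonneg_right
    (h.moment_dir x hx w hw) (by positivity)) zero_le_two) (mul_le_mul ?_ b1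
    (integral_nonneg fun ξ => by positivity) (by positivity))
  gcongr

/-- The exponential moment of one step of the error process. -/
theorem RefinedNoise.integral_exp_le (h : RefinedNoise X gradf g μ p σs σl)
    (hp1 : 1 < p) (hp : p ≤ 2) (hτ : 0 < τ) (hGτ : G ≤ τ / 2) {x : EuclideanSpace ℝ (Fin d)}
    (hx : x ∈ X) (hG : ‖gradf x‖ ≤ G) {lam η R : ℝ} (hlam : 0 ≤ lam) (hη : 0 ≤ η)
    (hsmall : lam * (3 / 2 * τ * R + η * (3 / 2 * τ) ^ 2) ≤ 1)
    {u : EuclideanSpace ℝ (Fin d)} (hu : ‖u‖ ≤ R) :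
    ∫⁻ ξ, ENNReal.ofReal (Real.exp (lam * (inner ℝ (clip τ (g x ξ) - gradf x) u
        + η * ‖clip τ (g x ξ) - gradf x‖ ^ 2))) ∂μ
      ≤ ENNReal.ofReal (Real.exp (lam * R * biasBound p σs σl G τ
        + 3 * lam * η * varBound p σl σl G τ + 2 * lam ^ 2 * R ^ 2 * varBound p σs σl G τ)) := by
  have hR : 0 ≤ R := (norm_nonneg u).trans hu
  have hG0 : 0 ≤ G := (norm_nonneg _).trans hG
  have hσl := h.σl_nonneg
  have hσs := h.σs_nonneg
  have hb0 : 0 ≤ biasBound p σs σl G τ := by unfold biasBound; positivity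
  have hv0 : 0 ≤ varBound p σs σl G τ := by unfold varBound; positivity
  set ε : Ξ → EuclideanSpace ℝ (Fin d) := fun ξ => clip τ (g x ξ) - gradf x with hε
  have hεm : Measurable ε := ((measurable_clip τ).comp (h.measurable_apply hx)).sub_const _
  have hεb : ∀ ξ, ‖ε ξ‖ ≤ 3 / 2 * τ := fun ξ => norm_clip_sub_le hτ.le (hG.trans hGτ)
  have hεb2 : ∀ ξ, ‖ε ξ‖ ^ 2 ≤ (3 / 2 * τ) ^ 2 := fun ξ => by gcongr; exact hεb ξ
  have hib : ∀ ξ, |inner ℝ (ε ξ) u| ≤ 3 / 2 * τ * R := fun ξ =>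
    (abs_real_inner_le_norm _ _).trans (by gcongr; exact hεb ξ)
  have i1 : Integrable (fun ξ => inner ℝ (ε ξ) u) μ :=
    (h.integrable_clip_sub hτ hx).inner_const u
  have i2 : Integrable (fun ξ => inner ℝ (ε ξ) u ^ 2) μ :=
    Integrable.of_bound (by fun_prop) ((3 / 2 * τ * R) ^ 2) (ae_of_all _ fun ξ => by
      rw [Real.norm_of_nonneg (sq_nonneg _), ← sq_abs]
      gcongr
      exact hib ξ)
  have i3 : Integrable (fun ξ => ‖ε ξ‖ ^ 2) μ :=
    Integrable.of_bound (by fun_prop) ((3 / 2 * τ) ^ 2) (ae_of_all _ fun ξ => by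
      rw [Real.norm_of_nonneg (sq_nonneg _)]
      exact hεb2 ξ)
  have b1 : ∫ ξ, inner ℝ (ε ξ) u ∂μ ≤ R * biasBound p σs σl G τ := by
    rcases eq_or_ne u 0 with rfl | hu0
    · simp only [inner_zero_right, integral_zero]
      positivity
    · have hn := norm_ne_zero_iff.2 hu0
      have hw : ‖(‖u‖⁻¹ • u)‖ = 1 := by rw [norm_smul, norm_inv, norm_norm, inv_mul_cancel₀ hn]
      have := h.integral_inner_clip_sub_le hp1 hτ hGτ hx hG hw
      calc ∫ ξ, inner ℝ (ε ξ) u ∂μ = ‖u‖ * ∫ ξ, inner ℝ (‖u‖⁻¹ • u) (ε ξ) ∂μ := by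
            rw [← integral_const_mul]
            congr 1 with ξ
            rw [real_inner_smul_left, mul_inv_cancel_left₀ hn, real_inner_comm]
        _ ≤ ‖u‖ * biasBound p σs σl G τ := by gcongr
        _ ≤ _ := by gcongr
  have b2 : ∫ ξ, inner ℝ (ε ξ) u ^ 2 ∂μ ≤ R ^ 2 * varBound p σs σl G τ := by
    rcases eq_or_ne u 0 with rfl | hu0
    · simp only [inner_zero_right, ne_eq, OfNat.ofNat_ne_zero, not_false_eq_true, zero_pow,
        integral_zero]
      positivity
    · have hn := norm_ne_zero_iff.2 hu0
      have hw : ‖(‖u‖⁻¹ • u)‖ = 1 := by rw [norm_smul, norm_inv, norm_norm, inv_mul_cancel₀ hn]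
      have := h.integral_inner_clip_sub_sq_le hp1 hp hτ hGτ hx hG hw
      calc ∫ ξ, inner ℝ (ε ξ) u ^ 2 ∂μ = ‖u‖ ^ 2 * ∫ ξ, inner ℝ (‖u‖⁻¹ • u) (ε ξ) ^ 2 ∂μ := by
            rw [← integral_const_mul]
            congr 1 with ξ
            rw [real_inner_smul_left, ← mul_pow, mul_inv_cancel_left₀ hn, real_inner_comm]
        _ ≤ ‖u‖ ^ 2 * varBound p σs σl G τ := by gcongr
        _ ≤ _ := by gcongr
  have b3 : ∫ ξ, ‖ε ξ‖ ^ 2 ∂μ ≤ varBound p σl σl G τ :=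
    h.integral_norm_clip_sub_sq_le hp1 hp hτ hGτ hx hG
  -- For `|a + b| ≤ 1` and `0 ≤ b ≤ 1`, `e^(a+b) ≤ 1 + (a + b) + (a + b)²`, while `(a + b)² ≤ 2a² +
  -- 2b²` and `b² ≤ b`. The linear term in `a` is left exact so that it contributes its mean, the
  -- bias.
  have hpt : ∀ ξ, Real.exp (lam * (inner ℝ (ε ξ) u + η * ‖ε ξ‖ ^ 2))
      ≤ 1 + lam * inner ℝ (ε ξ) u + 3 * lam * η * ‖ε ξ‖ ^ 2
        + 2 * lam ^ 2 * inner ℝ (ε ξ) u ^ 2 := by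
    intro ξ
    have q0 : 0 ≤ η * ‖ε ξ‖ ^ 2 := by positivity
    have q1 : η * ‖ε ξ‖ ^ 2 ≤ η * (3 / 2 * τ) ^ 2 := by gcongr; exact hεb ξ
    have q2 : |inner ℝ (ε ξ) u + η * ‖ε ξ‖ ^ 2| ≤ 3 / 2 * τ * R + η * (3 / 2 * τ) ^ 2 := by
      refine (abs_add_le _ _).trans ?_
      rw [abs_of_nonneg q0]
      exact add_le_add (hib ξ) q1
    have q3 : |lam * (inner ℝ (ε ξ) u + η * ‖ε ξ‖ ^ 2)| ≤ 1 := by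
      rw [abs_mul, abs_of_nonneg hlam]
      exact (mul_le_mul_of_nonneg_left q2 hlam).trans hsmall
    have q4 := (le_abs_self _).trans (Real.abs_exp_sub_one_sub_id_le q3)
    have q5 : lam * (η * ‖ε ξ‖ ^ 2) ≤ 1 := by
      refine (mul_le_mul_of_nonneg_left (q1.trans ?_) hlam).trans hsmall
      have : 0 ≤ 3 / 2 * τ * R := by positivity
      linarith
    have q6 : 0 ≤ lam * (η * ‖ε ξ‖ ^ 2) := by positivity
    nlinarith [sq_nonneg (lam * inner ℝ (ε ξ) u - lam * (η * ‖ε ξ‖ ^ 2))]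
  have i4 : Integrable (fun ξ => Real.exp (lam * (inner ℝ (ε ξ) u + η * ‖ε ξ‖ ^ 2))) μ := by
    refine Integrable.mono' ((((integrable_const (1 : ℝ)).add (i1.const_mul lam)).add
      (i3.const_mul (3 * lam * η))).add (i2.const_mul (2 * lam ^ 2)))
      (by fun_prop) (ae_of_all _ fun ξ => ?_)
    rw [Real.norm_of_nonneg (Real.exp_nonneg _)]
    exact hpt ξ
  rw [← ofReal_integral_eq_lintegral_ofReal i4 (ae_of_all _ fun ξ => Real.exp_nonneg _)]
  refine ENNReal.ofReal_le_ofReal ?_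
  have j1 := (integrable_const (μ := μ) (1 : ℝ)).add (i1.const_mul lam)
  have j2 := j1.add (i3.const_mul (3 * lam * η))
  refine (integral_mono i4 (j2.add (i2.const_mul (2 * lam ^ 2))) hpt).trans ?_
  rw [integral_add' j2 (i2.const_mul _), integral_add' j1 (i3.const_mul _),
    integral_add' (integrable_const _) (i1.const_mul _), integral_const_mul, integral_const_mul,
    integral_const_mul, integral_const, probReal_univ, one_smul]
  refine le_trans ?_ (Real.add_one_le_exp _)
  have c1 := mul_le_mul_of_nonneg_left b1 hlam
  have c2 := mul_le_mul_of_nonneg_left b2 (by positivity : 0 ≤ 2 * lam ^ 2)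
  have c3 := mul_le_mul_of_nonneg_left b3 (by positivity : 0 ≤ 3 * lam * η)
  linarith

end Noise

/-! ### The parameters `φ`, `A`, `τ⋆` and `η⋆` -/

section Parameters

variable {p σs σl G D δ : ℝ} {T : ℕ}

theorem one_le_log_three_div (h0 : 0 < δ) (h1 : δ ≤ 1) : 1 ≤ Real.log (3 / δ) := by
  rw [Real.le_log_iff_exp_le (by positivity)]
  have : (3 : ℝ) ≤ 3 / δ := by
    rw [le_div_iff₀ h0]
    linarith
  linarith [Real.exp_one_lt_three]

theorem sqrt_dEff (hs : 0 ≤ σs) (hl : 0 ≤ σl) : √(dEff σs σl) = σl / σs := by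
  rw [dEff, ← div_pow, Real.sqrt_sq (by positivity)]

theorem phiStar_nonneg (h0 : 0 < δ) (h1 : δ ≤ 1) : 0 ≤ phiStar p σs σl δ :=
  le_max_of_le_left (mul_nonneg (Real.sqrt_nonneg _)
    (zero_le_one.trans (one_le_log_three_div h0 h1)))

theorem phi_term_nonneg (hG : 0 < G) (hl : 0 ≤ σl) (h0 : 0 < δ) (h1 : δ ≤ 1) (β : ℝ) :
    0 ≤ (1 - 1 / 2 : ℝ) ^ (β * p) * phiStar p σs σl δ ^ (1 - β) * (σl / G) ^ (β * p)
      * (T : ℝ) ^ β := by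
  have := phiStar_nonneg (p := p) (σs := σs) (σl := σl) h0 h1
  have : (0 : ℝ) ≤ 1 - 1 / 2 := by norm_num
  positivity

/-- Exhibits the terms of the infimum as weighted geometric means of `φ⋆` and of `T(σl/τ)^p` at the
smallest threshold `τ = 2G`. -/
theorem phi_term_eq (hG : 0 < G) (hl : 0 ≤ σl) (β : ℝ) (q : ℝ) :
    (1 - 1 / 2 : ℝ) ^ (β * p) * q ^ (1 - β) * (σl / G) ^ (β * p) * (T : ℝ) ^ β
      = q ^ (1 - β) * ((σl / (2 * G)) ^ p * T) ^ β := by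
  rw [Real.mul_rpow (by positivity) (by positivity), ← Real.rpow_mul (by positivity), mul_comm p β,
    show σl / (2 * G) = (1 - 1 / 2) * (σl / G) by field_simp; ring,
    Real.mul_rpow (by norm_num) (by positivity)]
  ring

theorem phi_nonneg (hG : 0 < G) (hl : 0 ≤ σl) (h0 : 0 < δ) (h1 : δ ≤ 1) :
    0 ≤ phi p σs σl G δ T :=
  Real.iInf_nonneg fun _ => phi_term_nonneg hG hl h0 h1 _

theorem phi_le_phiStar (hG : 0 < G) (hl : 0 ≤ σl) (h0 : 0 < δ) (h1 : δ ≤ 1) :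
    phi p σs σl G δ T ≤ phiStar p σs σl δ := by
  refine (ciInf_le ⟨0, ?_⟩ (⟨0, by simp⟩ : Set.Icc (0 : ℝ) (1 / 2))).trans_eq (by simp)
  rintro _ ⟨β, rfl⟩
  exact phi_term_nonneg hG hl h0 h1 _

/-- Geometric interpolation: a common lower bound of both endpoints is a lower bound of `φ`. -/
theorem le_phi {q : ℝ} (hG : 0 < G) (hl : 0 ≤ σl) (hq : 0 ≤ q)
    (hq1 : q ≤ phiStar p σs σl δ) (hq2 : q ≤ (σl / (2 * G)) ^ p * T) :
    q ≤ phi p σs σl G δ T := by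
  have : Nonempty (Set.Icc (0 : ℝ) (1 / 2)) := ⟨⟨0, by simp⟩⟩
  refine le_ciInf fun ⟨β, hβ0, hβ1⟩ => ?_
  rw [phi_term_eq hG hl]
  calc q = q ^ (1 - β) * q ^ β := by
        rw [← Real.rpow_add' hq (by norm_num), sub_add_cancel, Real.rpow_one]
    _ ≤ _ := by
        have : 0 ≤ 1 - β := by linarith
        gcongr
        exact Real.rpow_nonneg (hq.trans hq1) _

theorem phi_eq_phiStar (hG : 0 < G) (hl : 0 ≤ σl)
    (h0 : 0 < δ) (h1 : δ ≤ 1)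
    (hT : 2 ^ p * (G ^ p / σl ^ p) * phiStar p σs σl δ ≤ T) :
    phi p σs σl G δ T = phiStar p σs σl δ := by
  refine le_antisymm (phi_le_phiStar hG hl h0 h1) ?_
  rcases hl.eq_or_lt with h | h
  · have : phiStar p σs σl δ = 0 := by
      simp [phiStar, dEff, ← h]
    rw [this]
    exact phi_nonneg hG hl h0 h1
  · refine le_phi hG hl (phiStar_nonneg h0 h1) le_rfl ?_
    rw [Real.div_rpow hl (by positivity), Real.mul_rpow zero_le_two hG.le,
      div_mul_eq_mul_div, le_div_iff₀ (by positivity), mul_comm]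
    calc 2 ^ p * G ^ p * phiStar p σs σl δ
        = σl ^ p * (2 ^ p * (G ^ p / σl ^ p) * phiStar p σs σl δ) := by
          have : 0 < σl ^ p := by positivity
          field_simp
      _ ≤ _ := by gcongr

theorem domCoeff_eq (hp1 : 1 < p) (hs : 0 < σs) (hl : 0 < σl) :
    domCoeff p σs σl δ =
      σl * (dEff σs σl ^ (-((2 - p) / (2 * p))) +
        dEff σs σl ^ (-(1 / (2 * p))) * Real.log (3 / δ) ^ (1 - 1 / p)) := by
  have hp0 : p ≠ 0 := by linarith
  have e1 : ∀ y : ℝ, σl * dEff σs σl ^ (-(y / (2 * p))) = σs ^ (y / p) * σl ^ (1 - y / p) := by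
    intro y
    rw [dEff, ← div_pow, ← Real.rpow_natCast, ← Real.rpow_mul (by positivity),
      Real.div_rpow hl.le hs.le,
      show ((2 : ℕ) : ℝ) * -(y / (2 * p)) = -(y / p) by push_cast; ring,
      Real.rpow_neg hs.le, Real.rpow_neg hl.le, Real.rpow_sub hl, Real.rpow_one]
    field_simp
  rw [mul_add, ← mul_assoc, e1, e1, domCoeff, show (2 - p) / p = 2 / p - 1 by field_simp,
    show 1 - (2 / p - 1) = 2 - 2 / p by ring]

theorem domCoeff_nonneg (hs : 0 ≤ σs) (hl : 0 ≤ σl) (h0 : 0 < δ) (h1 : δ ≤ 1) :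
    0 ≤ domCoeff p σs σl δ := by
  have := one_le_log_three_div h0 h1
  unfold domCoeff
  positivity

theorem domCoeff_zero (hp1 : 1 < p) : domCoeff p 0 0 δ = 0 := by
  have hp0 : 0 < p := by linarith
  have h1 : 2 - 2 / p ≠ 0 := by
    have : 2 / p < 2 := by rw [div_lt_iff₀ hp0]; linarith
    linarith
  have h2 : 1 / p ≠ 0 := by positivity
  simp [domCoeff, Real.zero_rpow h1, Real.zero_rpow h2, -one_div]

theorem domCoeff_pos (hs : 0 < σs) (hl : 0 < σl) (h0 : 0 < δ) (h1 : δ ≤ 1) :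
    0 < domCoeff p σs σl δ := by
  have := one_le_log_three_div h0 h1
  unfold domCoeff
  positivity

theorem tauStar_zero (hp1 : 1 < p) : tauStar p 0 0 δ = 0 := by
  have hp0 : 0 < p := by linarith
  simp [tauStar, Real.zero_rpow (one_div_pos.2 hp0).ne', -one_div]

/-- `D / η⋆` lies between each of the reciprocal entries of the minimum defining `η⋆` and their
sum. -/
theorem etaStar_spec (hp1 : 1 < p) (hG : 0 < G) (hD : 0 < D) (hs : 0 ≤ σs) (hl : 0 ≤ σl)
    (hsl : σs ≤ σl) (hpos : 0 < σl → 0 < σs) (h0 : 0 < δ) (h1 : δ ≤ 1) (hT : 1 ≤ T) :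
    0 < etaStar p σs σl G D δ T ∧
    G * (phi p σs σl G δ T + Real.log (3 / δ)) ≤ D / etaStar p σs σl G D δ T ∧
    G * √((σl ^ p / G ^ p + 1) * T) ≤ D / etaStar p σs σl G D δ T ∧
    domCoeff p σs σl δ * (T : ℝ) ^ (1 / p) ≤ D / etaStar p σs σl G D δ T ∧
    D / etaStar p σs σl G D δ T ≤ G * (phi p σs σl G δ T + Real.log (3 / δ)) +
      G * √((σl ^ p / G ^ p + 1) * T) + domCoeff p σs σl δ * (T : ℝ) ^ (1 / p) := by
  have hT0 : (0 : ℝ) < T := by exact_mod_cast hT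
  have hL := one_le_log_three_div h0 h1
  have hφ := phi_nonneg (p := p) (σs := σs) (T := T) hG hl h0 h1
  set a := phi p σs σl G δ T + Real.log (3 / δ) with ha
  have ha0 : 0 < a := by linarith
  set b := √((σl ^ p / G ^ p + 1) * T) with hb
  have hb0 : 0 < b := Real.sqrt_pos.2 (by positivity)
  have hA0 := domCoeff_nonneg (p := p) hs hl h0 h1
  set c := domCoeff p σs σl δ * (T : ℝ) ^ (1 / p) with hc
  have hc0 : 0 ≤ c := by positivity
  have ea : D / G / a = D / (G * a) := by rw [div_div]
  have eb : D / G / b = D / (G * b) := by rw [div_div]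
  have hGa : 0 < G * a := by positivity
  have hGb : 0 < G * b := by positivity
  -- The witness `m` is the maximum of the reciprocal entries. In the noiseless case `A = 0`, so the
  -- entry left out of the minimum is harmless.
  have key : ∃ m, etaStar p σs σl G D δ T = D / m ∧ 0 < m ∧ G * a ≤ m ∧ G * b ≤ m ∧ c ≤ m ∧
      m ≤ G * a + G * b + c := by
    by_cases h : σl = 0
    · have hs0 : σs = 0 := le_antisymm (hsl.trans h.le) hs
      have hc' : c = 0 := by rw [hc, h, hs0, domCoeff_zero hp1, zero_mul]
      refine ⟨max (G * a) (G * b), ?_, by positivity, le_max_left _ _, le_max_right _ _, ?_, ?_⟩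
      · simp only [etaStar, if_pos h]
        rw [← ha, ← hb, ea, eb]
        rcases le_total (G * a) (G * b) with h' | h'
        · rw [max_eq_right h', min_eq_right (div_le_div_of_nonneg_left hD.le hGa h')]
        · rw [max_eq_left h', min_eq_left (div_le_div_of_nonneg_left hD.le hGb h')]
      · rw [hc']; positivity
      · refine max_le ?_ ?_ <;> linarith
    · have hl' : 0 < σl := lt_of_le_of_ne hl (Ne.symm h)
      have hc' : 0 < c := mul_pos (domCoeff_pos (hpos hl') hl' h0 h1) (by positivity)
      refine ⟨max (max (G * a) (G * b)) c, ?_, by positivity,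
        (le_max_left _ _).trans (le_max_left _ _), (le_max_right _ _).trans (le_max_left _ _),
        le_max_right _ _, ?_⟩
      · simp only [etaStar, if_neg h]
        rw [← ha, ← hb, ← hc, ea, eb]
        have e1 : min (D / (G * a)) (D / (G * b)) = D / max (G * a) (G * b) := by
          rcases le_total (G * a) (G * b) with h' | h'
          · rw [max_eq_right h', min_eq_right (div_le_div_of_nonneg_left hD.le hGa h')]
          · rw [max_eq_left h', min_eq_left (div_le_div_of_nonneg_left hD.le hGb h')]
        have hm : 0 < max (G * a) (G * b) := by positivity
        rw [e1]
        rcases le_total (max (G * a) (G * b)) c with h' | h'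
        · rw [max_eq_right h', min_eq_right (div_le_div_of_nonneg_left hD.le hm h')]
        · rw [max_eq_left h', min_eq_left (div_le_div_of_nonneg_left hD.le hc' h')]
      · refine max_le (max_le ?_ ?_) ?_ <;> linarith
  obtain ⟨m, e, hm0, k1, k2, k3, k4⟩ := key
  rw [e, div_div_cancel₀ hD.ne']
  exact ⟨by positivity, k1, k2, k3, k4⟩

theorem tauStar_nonneg (hs : 0 ≤ σs) (hl : 0 ≤ σl) (h0 : 0 < δ) (h1 : δ ≤ 1) :
    0 ≤ tauStar p σs σl δ := by
  have := one_le_log_three_div h0 h1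
  unfold tauStar
  split_ifs <;> positivity

theorem tauStar_rpow (hp1 : 1 < p) (hs : 0 ≤ σs) (hl : 0 ≤ σl) (h0 : 0 < δ) (h1 : δ ≤ 1) :
    tauStar p σs σl δ ^ p = if p < 2 then
      min (σs * σl ^ (p - 1) / Real.log (3 / δ)) (σs ^ 2 / σl ^ (2 - p))
    else σs * σl ^ (p - 1) / Real.log (3 / δ) := by
  have := one_le_log_three_div h0 h1
  rw [tauStar, ← Real.rpow_mul (by split_ifs <;> positivity),
    one_div_mul_cancel (by linarith), Real.rpow_one]

end Parameters

/-! ### Total bias and variance at the chosen threshold -/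

section Bounds

variable {p σs σl G δ h τ : ℝ} {T : ℕ}

theorem rpow_mul_le_of_mul_rpow_one_div_le {a : ℝ} (hp1 : 1 < p) (ha : 0 ≤ a)
    (hle : a * (T : ℝ) ^ (1 / p) ≤ h) : a ^ p * T ≤ h ^ p := by
  have hp0 : p ≠ 0 := by linarith
  calc a ^ p * T = (a * (T : ℝ) ^ (1 / p)) ^ p := by
        rw [Real.mul_rpow ha (by positivity), ← Real.rpow_mul (by positivity),
          one_div_mul_cancel hp0, Real.rpow_one]
    _ ≤ _ := Real.rpow_le_rpow (by positivity) hle (by linarith)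

/-- Keeping one summand of `A` and taking the `p`-th power clears the fractional exponents. This
summand is matched with the entry `σs²/σl^(2-p)` of `τ⋆`; the other one, treated next, handles the
factors `ln(3/δ)`. -/
theorem domCoeff_fst_rpow_mul_le (hp1 : 1 < p) (hs : 0 < σs) (hl : 0 < σl)
    (h0 : 0 < δ) (h1 : δ ≤ 1) (hA : domCoeff p σs σl δ * (T : ℝ) ^ (1 / p) ≤ h) :
    σs ^ (2 - p) * σl ^ (2 * p - 2) * T ≤ h ^ p := by
  have hL := one_le_log_three_div h0 h1
  have hp0 : p ≠ 0 := by linarith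
  have := rpow_mul_le_of_mul_rpow_one_div_le (a := σs ^ (2 / p - 1) * σl ^ (2 - 2 / p)) (T := T)
    (h := h) hp1 (by positivity) (le_trans (by
      refine mul_le_mul_of_nonneg_right ?_ (by positivity)
      rw [domCoeff]
      exact le_add_of_nonneg_right (by positivity)) hA)
  rwa [Real.mul_rpow (by positivity) (by positivity), ← Real.rpow_mul hs.le,
    ← Real.rpow_mul hl.le, show (2 / p - 1) * p = 2 - p by field_simp,
    show (2 - 2 / p) * p = 2 * p - 2 by field_simp] at this

theorem domCoeff_snd_rpow_mul_le (hp1 : 1 < p) (hs : 0 < σs) (hl : 0 < σl)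
    (h0 : 0 < δ) (h1 : δ ≤ 1) (hA : domCoeff p σs σl δ * (T : ℝ) ^ (1 / p) ≤ h) :
    σs * σl ^ (p - 1) * Real.log (3 / δ) ^ (p - 1) * T ≤ h ^ p := by
  have hL := one_le_log_three_div h0 h1
  have hp0 : p ≠ 0 := by linarith
  have := rpow_mul_le_of_mul_rpow_one_div_le
    (a := σs ^ (1 / p) * σl ^ (1 - 1 / p) * Real.log (3 / δ) ^ (1 - 1 / p)) (T := T)
    (h := h) hp1 (by positivity) (le_trans (by
      refine mul_le_mul_of_nonneg_right ?_ (by positivity)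
      rw [domCoeff]
      exact le_add_of_nonneg_left (by positivity)) hA)
  rwa [Real.mul_rpow (by positivity) (by positivity), Real.mul_rpow (by positivity)
    (by positivity), ← Real.rpow_mul hs.le,
    ← Real.rpow_mul hl.le, ← Real.rpow_mul (by linarith), show (1 / p) * p = 1 by field_simp,
    show (1 - 1 / p) * p = p - 1 by field_simp, Real.rpow_one] at this

theorem tauStar_rpow_mul_le (hp1 : 1 < p) (hs : 0 ≤ σs) (hl : 0 ≤ σl) (h0 : 0 < δ)
    (h1 : δ ≤ 1) :
    tauStar p σs σl δ ^ p * Real.log (3 / δ) ≤ σs * σl ^ (p - 1) := by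
  have hL := one_le_log_three_div h0 h1
  rw [← le_div_iff₀ (by linarith), tauStar_rpow hp1 hs hl h0 h1]
  split_ifs
  · exact min_le_left _ _
  · exact le_rfl

theorem two_mul_le_threshold : 2 * G ≤ threshold p σs σl G δ T :=
  le_trans (by norm_num; linarith) (le_max_left _ _)

/-- The clipped errors have size of order `τ`, so this bound permits an exponential parameter of
order `ln(3/δ)/(Dh)`. The value `2G` is paid by the first entry of `η⋆`, and `τ⋆T^(1/p)` by the
logarithmic summand of `A`. -/
theorem threshold_mul_log_le (hp1 : 1 < p) (hG : 0 < G) (hs : 0 ≤ σs) (hl : 0 ≤ σl)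
    (hsl : σs ≤ σl) (hpos : 0 < σl → 0 < σs) (h0 : 0 < δ) (h1 : δ ≤ 1) (hh : 0 < h)
    (hφ : G * (phi p σs σl G δ T + Real.log (3 / δ)) ≤ h)
    (hA : domCoeff p σs σl δ * (T : ℝ) ^ (1 / p) ≤ h) :
    threshold p σs σl G δ T * Real.log (3 / δ) ≤ 2 * h := by
  have hL := one_le_log_three_div h0 h1
  have hφ0 := phi_nonneg (p := p) (σs := σs) (T := T) hG hl h0 h1
  rw [threshold, max_mul_of_nonneg _ _ (by linarith)]
  refine max_le ?_ ?_
  · have : 0 ≤ G * phi p σs σl G δ T := by positivity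
    rw [show G / (1 - 1 / 2) = 2 * G by norm_num; ring]
    linarith
  · rcases hl.eq_or_lt with hl0 | hl0
    · have hs0 : σs = 0 := le_antisymm (hsl.trans hl0.ge) hs
      rw [← hl0, hs0, tauStar_zero hp1]
      simpa using hh.le
    · have hs0 := hpos hl0
      have ht := tauStar_nonneg (p := p) hs hl h0 h1
      have k1 := tauStar_rpow_mul_le hp1 hs hl h0 h1
      have k2 := domCoeff_snd_rpow_mul_le hp1 hs0 hl0 h0 h1 hA
      have k3 : (tauStar p σs σl δ * (T : ℝ) ^ (1 / p) * Real.log (3 / δ)) ^ p ≤ h ^ p := by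
        rw [Real.mul_rpow (by positivity) (by positivity), Real.mul_rpow (by positivity)
          (by positivity), ← Real.rpow_mul (by positivity), one_div_mul_cancel (by linarith),
          Real.rpow_one]
        calc tauStar p σs σl δ ^ p * T * Real.log (3 / δ) ^ p
            = tauStar p σs σl δ ^ p * Real.log (3 / δ) * Real.log (3 / δ) ^ (p - 1) * T := by
              rw [Real.rpow_sub (by linarith), Real.rpow_one]
              field_simp
          _ ≤ σs * σl ^ (p - 1) * Real.log (3 / δ) ^ (p - 1) * T := by gcongr
          _ ≤ _ := k2
      have := (Real.rpow_le_rpow_iff (by positivity) hh.le (by linarith)).1 k3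
      linarith

/-- A lower bound on the `p`-th power of the threshold, one of two cases. -/
theorem le_threshold_rpow (hp1 : 1 < p) (hs : 0 ≤ σs) (hl : 0 ≤ σl)
    (h0 : 0 < δ) (h1 : δ ≤ 1) :
    σs * σl ^ (p - 1) / Real.log (3 / δ) * T ≤ threshold p σs σl G δ T ^ p ∨
      p < 2 ∧ σs ^ 2 / σl ^ (2 - p) * T ≤ threshold p σs σl G δ T ^ p := by
  have ht := tauStar_nonneg (p := p) hs hl h0 h1
  have key : tauStar p σs σl δ ^ p * T ≤ threshold p σs σl G δ T ^ p :=
    rpow_mul_le_of_mul_rpow_one_div_le hp1 ht (le_max_right _ _)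
  rw [tauStar_rpow hp1 hs hl h0 h1] at key
  split_ifs at key with hp2
  · rcases le_total (σs * σl ^ (p - 1) / Real.log (3 / δ)) (σs ^ 2 / σl ^ (2 - p)) with h' | h'
    · rw [min_eq_left h'] at key
      exact Or.inl key
    · rw [min_eq_right h'] at key
      exact Or.inr ⟨hp2, key⟩
  · exact Or.inl key

/-- This is the purpose of `φ`: up to a constant, the left side bounds the expected number of
clipped samples. It is at most `φ⋆` because `τ ≥ τ⋆T^(1/p)`, and at most the other endpoint because
`τ ≥ 2G`, hence below every interpolation between them. -/
theorem mul_rpow_div_threshold_le_phi (hp1 : 1 < p) (hG : 0 < G) (hs : 0 < σs) (hl : 0 < σl)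
    (h0 : 0 < δ) (h1 : δ ≤ 1) :
    T * (σl / threshold p σs σl G δ T) ^ p ≤ phi p σs σl G δ T := by
  have hL := one_le_log_three_div h0 h1
  have h2 := two_mul_le_threshold (p := p) (σs := σs) (σl := σl) (G := G) (δ := δ) (T := T)
  have hor := le_threshold_rpow (T := T) (G := G) hp1 hs.le hl.le h0 h1
  set τ := threshold p σs σl G δ T
  have hτ : 0 < τ := by linarith
  refine le_phi hG hl.le (by positivity) ?_ ?_
  · rw [Real.div_rpow hl.le hτ.le, mul_div_assoc', div_le_iff₀ (by positivity)]
    rcases hor with h | ⟨hp2, h⟩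
    · calc T * σl ^ p = (σl / σs * Real.log (3 / δ))
            * (σs * σl ^ (p - 1) / Real.log (3 / δ) * T) := by
            rw [Real.rpow_sub hl, Real.rpow_one]
            field_simp
        _ ≤ phiStar p σs σl δ * τ ^ p := by
          have : σl / σs * Real.log (3 / δ) ≤ phiStar p σs σl δ := by
            rw [← sqrt_dEff hs.le hl.le]
            exact le_max_left _ _
          have := phiStar_nonneg (p := p) (σs := σs) (σl := σl) h0 h1
          gcongr
    · calc T * σl ^ p = (σl ^ 2 / σs ^ 2) * (σs ^ 2 / σl ^ (2 - p) * T) := by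
            rw [Real.rpow_sub hl, Real.rpow_two]
            field_simp
        _ ≤ phiStar p σs σl δ * τ ^ p := by
          have : σl ^ 2 / σs ^ 2 ≤ phiStar p σs σl δ := by
            refine le_trans (le_of_eq ?_) (le_max_right _ _)
            simp [dEff, hp2]
          have := phiStar_nonneg (p := p) (σs := σs) (σl := σl) h0 h1
          gcongr
  · rw [mul_comm]
    gcongr

/-- The `p`-th power of the left side factors, for either entry of `τ⋆`, into the matching summand
bound of `A` and the `(p-1)`-th power of the lower bound on `τ^p`. -/
theorem mul_div_threshold_rpow_le (hp1 : 1 < p) (hG : 0 < G) (hs : 0 < σs) (hl : 0 < σl)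
    (h0 : 0 < δ) (h1 : δ ≤ 1) (hT : 1 ≤ T) (hh : 0 < h)
    (hA : domCoeff p σs σl δ * (T : ℝ) ^ (1 / p) ≤ h) :
    T * (σs * (σl / threshold p σs σl G δ T) ^ (p - 1)) ≤ h := by
  have hT0 : (0 : ℝ) < T := by exact_mod_cast hT
  have hL := one_le_log_three_div h0 h1
  have h2 := two_mul_le_threshold (p := p) (σs := σs) (σl := σl) (G := G) (δ := δ) (T := T)
  have hor := le_threshold_rpow (T := T) (G := G) hp1 hs.le hl.le h0 h1
  have k1 := domCoeff_fst_rpow_mul_le hp1 hs hl h0 h1 hA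
  have k2 := domCoeff_snd_rpow_mul_le hp1 hs hl h0 h1 hA
  set τ := threshold p σs σl G δ T
  set L := Real.log (3 / δ)
  have hτ : 0 < τ := by linarith
  have hL0 : 0 < L := by linarith
  rw [Real.div_rpow hl.le hτ.le, ← mul_div_assoc, ← mul_div_assoc, div_le_iff₀ (by positivity)]
  refine (Real.rpow_le_rpow_iff (by positivity) (by positivity) (by linarith : 0 < p)).1 ?_
  rw [Real.mul_rpow hh.le (by positivity), ← Real.rpow_mul hτ.le, mul_comm (p - 1) p,
    Real.rpow_mul hτ.le]
  have hp0 : 0 ≤ p - 1 := by linarith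
  rcases hor with h' | ⟨hp2, h'⟩
  · calc (T * (σs * σl ^ (p - 1))) ^ p
        = (σs * σl ^ (p - 1) * L ^ (p - 1) * T) * (σs * σl ^ (p - 1) / L * T) ^ (p - 1) := by
          have hu : 0 < σs * σl ^ (p - 1) := by positivity
          generalize σs * σl ^ (p - 1) = u at hu ⊢
          rw [Real.mul_rpow hT0.le hu.le, Real.mul_rpow (by positivity) hT0.le,
            Real.div_rpow hu.le hL0.le]
          have e : ∀ y : ℝ, 0 < y → y ^ p = y * y ^ (p - 1) := fun y hy => by
            rw [Real.rpow_sub hy, Real.rpow_one]; field_simp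
          rw [e T hT0, e u hu]
          field_simp
      _ ≤ _ := by gcongr
  · calc (T * (σs * σl ^ (p - 1))) ^ p
        = (σs ^ (2 - p) * σl ^ (2 * p - 2) * T) * (σs ^ 2 / σl ^ (2 - p) * T) ^ (p - 1) := by
          -- Writing all bases as exponentials turns the identity of real powers into a polynomial
          -- identity between the exponents.
          obtain ⟨a, rfl⟩ : ∃ a, Real.exp a = σs := ⟨_, Real.exp_log hs⟩
          obtain ⟨b, rfl⟩ : ∃ b, Real.exp b = σl := ⟨_, Real.exp_log hl⟩
          obtain ⟨t, ht⟩ : ∃ t, Real.exp t = (T : ℝ) := ⟨_, Real.exp_log hT0⟩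
          rw [← ht]
          simp only [← Real.exp_mul, ← Real.exp_add, ← Real.exp_sub, ← Real.exp_nat_mul]
          congr 1
          push_cast
          ring
      _ ≤ _ := by gcongr

/-- If `τ = 2G`, the second entry of `η⋆` pays for the variance. Otherwise `τ⋆^p ≤ σs²/σl^(2-p)`
bounds its `p`-th power by the square of the first-summand bound of `A`. -/
theorem threshold_variance_le (hp1 : 1 < p) (hp : p ≤ 2) (hG : 0 < G) (hs : 0 < σs) (hl : 0 < σl)
    (h0 : 0 < δ) (h1 : δ ≤ 1) (hT : 1 ≤ T) (hh : 0 < h)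
    (hV : G * √((σl ^ p / G ^ p + 1) * T) ≤ h)
    (hA : domCoeff p σs σl δ * (T : ℝ) ^ (1 / p) ≤ h) :
    T * (σl ^ p * threshold p σs σl G δ T ^ (2 - p)) ≤ 2 * h ^ 2 := by
  have hT0 : (0 : ℝ) < T := by exact_mod_cast hT
  have hp2 : 0 ≤ 2 - p := by linarith
  have ht := tauStar_nonneg (p := p) hs.le hl.le h0 h1
  rcases le_total (tauStar p σs σl δ * (T : ℝ) ^ (1 / p)) (G / (1 - 1 / 2)) with h' | h'
  · rw [threshold, max_eq_left h', show G / (1 - 1 / 2) = 2 * G by norm_num; ring]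
    have k : (G * √((σl ^ p / G ^ p + 1) * T)) ^ 2 ≤ h ^ 2 := by gcongr
    rw [mul_pow, Real.sq_sqrt (by positivity)] at k
    have e : T * (σl ^ p * (2 * G) ^ (2 - p)) = 2 ^ (2 - p) * (G ^ 2 * (σl ^ p / G ^ p * T)) := by
      rw [Real.mul_rpow zero_le_two hG.le, Real.rpow_sub hG, Real.rpow_two]
      field_simp
    have e2 : (2 : ℝ) ^ (2 - p) ≤ 2 := by
      conv_rhs => rw [← Real.rpow_one 2]
      exact Real.rpow_le_rpow_of_exponent_le one_le_two (by linarith)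
    have k2 : G ^ 2 * (σl ^ p / G ^ p * T) ≤ h ^ 2 := by
      have : 0 ≤ G ^ 2 * T := by positivity
      linarith
    rw [e]
    gcongr
  · rw [threshold, max_eq_right h']
    have k1 := domCoeff_fst_rpow_mul_le hp1 hs hl h0 h1 hA
    -- For `p = 2` this entry of `τ⋆` is absent, but then the threshold has exponent `2 - p = 0`.
    have hτp : tauStar p σs σl δ ^ p ≤ σs ^ 2 / σl ^ (2 - p) ∨ p = 2 := by
      rcases hp.lt_or_eq with h2 | h2
      · left
        rw [tauStar_rpow hp1 hs.le hl.le h0 h1, if_pos h2]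
        exact min_le_right _ _
      · exact Or.inr h2
    have key : (tauStar p σs σl δ ^ p) ^ (2 - p) ≤ (σs ^ 2 / σl ^ (2 - p)) ^ (2 - p) := by
      rcases hτp with h2 | h2
      · gcongr
      · simp [h2]
    have k3 : (T * (σl ^ p * (tauStar p σs σl δ * (T : ℝ) ^ (1 / p)) ^ (2 - p))) ^ p
        ≤ (h ^ 2) ^ p := by
      have e0 : (tauStar p σs σl δ * (T : ℝ) ^ (1 / p)) ^ p = tauStar p σs σl δ ^ p * T := by
        rw [Real.mul_rpow ht (by positivity), ← Real.rpow_mul hT0.le,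
          one_div_mul_cancel (by linarith), Real.rpow_one]
      rw [Real.mul_rpow hT0.le (by positivity), Real.mul_rpow (by positivity) (by positivity),
        ← Real.rpow_mul (by positivity : 0 ≤ tauStar p σs σl δ * (T : ℝ) ^ (1 / p)),
        mul_comm (2 - p) p, Real.rpow_mul (by positivity), e0,
        Real.mul_rpow (by positivity) hT0.le]
      calc (T : ℝ) ^ p * ((σl ^ p) ^ p * ((tauStar p σs σl δ ^ p) ^ (2 - p) * (T : ℝ) ^ (2 - p)))
          ≤ (T : ℝ) ^ p * ((σl ^ p) ^ p
            * ((σs ^ 2 / σl ^ (2 - p)) ^ (2 - p) * (T : ℝ) ^ (2 - p))) := by gcongr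
        _ = (σs ^ (2 - p) * σl ^ (2 * p - 2) * T) ^ 2 := by
          obtain ⟨a, ha⟩ : ∃ a, Real.exp a = σs := ⟨_, Real.exp_log hs⟩
          obtain ⟨b, hb⟩ : ∃ b, Real.exp b = σl := ⟨_, Real.exp_log hl⟩
          obtain ⟨t, ht⟩ : ∃ t, Real.exp t = (T : ℝ) := ⟨_, Real.exp_log hT0⟩
          rw [← ht, ← ha, ← hb]
          simp only [← Real.exp_mul, ← Real.exp_add, ← Real.exp_sub, ← Real.exp_nat_mul]
          congr 1
          push_cast
          ring
        _ ≤ (h ^ p) ^ 2 := by gcongr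
        _ = (h ^ 2) ^ p := by
          rw [← Real.rpow_natCast, ← Real.rpow_natCast, ← Real.rpow_mul hh.le,
            ← Real.rpow_mul hh.le, mul_comm]
    have := (Real.rpow_le_rpow_iff (by positivity) (by positivity) (by linarith)).1 k3
    linarith [sq_nonneg h]

/-- The logarithm splits as `L = L^(p-1) L^(2-p)`. The first factor goes with `σs^p ≤ σs σl^(p-1)`
into the second summand of `A`, the other into `(τL)^(2-p)`. -/
theorem threshold_dir_variance_le (hp1 : 1 < p) (hp : p ≤ 2) (hs : 0 < σs) (hl : 0 < σl)
    (hsl : σs ≤ σl) (h0 : 0 < δ) (h1 : δ ≤ 1) (hh : 0 < h) (hτ : 0 < τ)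
    (hτL : τ * Real.log (3 / δ) ≤ 2 * h)
    (hA : domCoeff p σs σl δ * (T : ℝ) ^ (1 / p) ≤ h) :
    T * Real.log (3 / δ) * (σs ^ p * τ ^ (2 - p)) ≤ 2 * h ^ 2 := by
  have hL := one_le_log_three_div h0 h1
  have k2 := domCoeff_snd_rpow_mul_le hp1 hs hl h0 h1 hA
  set L := Real.log (3 / δ)
  have hL0 : 0 < L := by linarith
  have hp2 : 0 ≤ 2 - p := by linarith
  have hp3 : 0 ≤ p - 1 := by linarith
  have e2 : (2 : ℝ) ^ (2 - p) ≤ 2 := by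
    conv_rhs => rw [← Real.rpow_one 2]
    exact Real.rpow_le_rpow_of_exponent_le one_le_two (by linarith)
  have e3 : σs ^ p ≤ σs * σl ^ (p - 1) := by
    calc σs ^ p = σs * σs ^ (p - 1) := by
          rw [Real.rpow_sub hs, Real.rpow_one]; field_simp
      _ ≤ _ := by gcongr
  calc T * L * (σs ^ p * τ ^ (2 - p)) = (σs ^ p * L ^ (p - 1) * T) * (τ * L) ^ (2 - p) := by
        rw [Real.mul_rpow hτ.le hL0.le, show p - 1 = 1 - (2 - p) by ring, Real.rpow_sub hL0,
          Real.rpow_one]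
        field_simp
    _ ≤ (σs * σl ^ (p - 1) * L ^ (p - 1) * T) * (2 * h) ^ (2 - p) := by gcongr
    _ ≤ h ^ p * (2 ^ (2 - p) * h ^ (2 - p)) := by
      rw [Real.mul_rpow zero_le_two hh.le]
      gcongr
    _ ≤ h ^ p * (2 * h ^ (2 - p)) := by gcongr
    _ = 2 * h ^ 2 := by
      rw [Real.rpow_sub hh, Real.rpow_two]
      field_simp

/-- In the exponential moment these totals carry factors of order `lam D`, `lam D/h` and `lam²
D²/L`. With `lam` of order `L/(Dh)`, each contribution is of order `L = ln(3/δ)`. -/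
theorem bounds_of_params (hp1 : 1 < p) (hp : p ≤ 2) (hG : 0 < G) (hs : 0 ≤ σs) (hl : 0 ≤ σl)
    (hsl : σs ≤ σl) (hpos : 0 < σl → 0 < σs) (h0 : 0 < δ) (h1 : δ ≤ 1) (hT : 1 ≤ T) (hh : 0 < h)
    (hφ : G * (phi p σs σl G δ T + Real.log (3 / δ)) ≤ h)
    (hV : G * √((σl ^ p / G ^ p + 1) * T) ≤ h)
    (hA : domCoeff p σs σl δ * (T : ℝ) ^ (1 / p) ≤ h) :
    T * biasBound p σs σl G (threshold p σs σl G δ T) ≤ 6 * h ∧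
    T * varBound p σl σl G (threshold p σs σl G δ T) ≤ 14 * h ^ 2 ∧
    T * Real.log (3 / δ) * varBound p σs σl G (threshold p σs σl G δ T) ≤ 14 * h ^ 2 := by
  have hτ2 := two_mul_le_threshold (p := p) (σs := σs) (σl := σl) (G := G) (δ := δ) (T := T)
  rcases hl.eq_or_lt with hl0 | hl0
  · have hs0 : σs = 0 := le_antisymm (hsl.trans hl0.ge) hs
    have z1 : (0 : ℝ) ^ p = 0 := Real.zero_rpow (by linarith)
    have z2 : (0 : ℝ) ^ (p - 1) = 0 := Real.zero_rpow (by linarith)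
    simp only [← hl0, hs0, biasBound, varBound, mul_zero, zero_div, z1, z2, zero_mul, add_zero]
    exact ⟨by positivity, by positivity, by positivity⟩
  · have hs0 := hpos hl0
    have hL := one_le_log_three_div h0 h1
    have hφ0 := phi_nonneg (p := p) (σs := σs) (T := T) hG hl h0 h1
    have hτL := threshold_mul_log_le (T := T) hp1 hG hs hl hsl hpos h0 h1 hh hφ hA
    have a1 := mul_rpow_div_threshold_le_phi (T := T) hp1 hG hs0 hl0 h0 h1
    have a2 := mul_div_threshold_rpow_le hp1 hG hs0 hl0 h0 h1 hT hh hA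
    have a3 := threshold_variance_le hp1 hp hG hs0 hl0 h0 h1 hT hh hV hA
    have a4 := threshold_dir_variance_le hp1 hp hs0 hl0 hsl h0 h1 hh
      (by linarith : 0 < threshold p σs σl G δ T) hτL hA
    set τ := threshold p σs σl G δ T
    set L := Real.log (3 / δ)
    set φ := phi p σs σl G δ T
    have hτ : 0 < τ := by linarith
    have hGφ : G * φ ≤ h := by
      have : 0 ≤ G * L := by positivity
      linarith
    have hGL : G * L ≤ h := by
      have : 0 ≤ G * φ := by positivity
      linarith
    -- Both `Gφ` and `GL` are at most `h` because `φ` and `ln(3/δ)` are added in the first entry of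
    -- `η⋆`.
    have hGφL : G ^ 2 * φ * L ≤ h ^ 2 := by
      calc G ^ 2 * φ * L = (G * φ) * (G * L) := by ring
        _ ≤ h * h := by gcongr
        _ = _ := by ring
    have hGφ2 : G ^ 2 * φ ≤ h ^ 2 :=
      (le_mul_of_one_le_right (by positivity) hL).trans hGφL
    have c1 : (2 : ℝ) ^ (p - 1) ≤ 2 := by
      conv_rhs => rw [← Real.rpow_one 2]
      exact Real.rpow_le_rpow_of_exponent_le one_le_two (by linarith)
    have c2 : (2 : ℝ) ^ p ≤ 4 := by
      calc (2 : ℝ) ^ p ≤ 2 ^ (2 : ℝ) := Real.rpow_le_rpow_of_exponent_le one_le_two hp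
        _ = 4 := by norm_num
    have c3 : (3 / 2 : ℝ) ^ (2 - p) ≤ 3 / 2 := by
      conv_rhs => rw [← Real.rpow_one (3 / 2)]
      exact Real.rpow_le_rpow_of_exponent_le (by norm_num) (by linarith)
    have d1 : T * (2 * σl / τ) ^ p ≤ 4 * φ := by
      rw [mul_div_assoc, Real.mul_rpow zero_le_two (by positivity)]
      calc T * (2 ^ p * (σl / τ) ^ p) = 2 ^ p * (T * (σl / τ) ^ p) := by ring
        _ ≤ _ := by gcongr
    refine ⟨?_, ?_, ?_⟩
    · have d2 : T * (σs * (2 * σl / τ) ^ (p - 1)) ≤ 2 * h := by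
        rw [mul_div_assoc, Real.mul_rpow zero_le_two (by positivity)]
        calc T * (σs * (2 ^ (p - 1) * (σl / τ) ^ (p - 1)))
            = 2 ^ (p - 1) * (T * (σs * (σl / τ) ^ (p - 1))) := by ring
          _ ≤ _ := by gcongr
      have := mul_le_mul_of_nonneg_left d1 hG.le
      rw [biasBound]
      linarith
    · have d2 : T * (σl ^ p * (3 / 2 * τ) ^ (2 - p)) ≤ 3 / 2 * (2 * h ^ 2) := by
        rw [Real.mul_rpow (by norm_num) hτ.le]
        calc T * (σl ^ p * ((3 / 2) ^ (2 - p) * τ ^ (2 - p)))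
            = (3 / 2) ^ (2 - p) * (T * (σl ^ p * τ ^ (2 - p))) := by ring
          _ ≤ _ := by gcongr
      have := mul_le_mul_of_nonneg_left d1 (sq_nonneg G)
      rw [varBound]
      linarith
    · have d2 : T * L * (σs ^ p * (3 / 2 * τ) ^ (2 - p)) ≤ 3 / 2 * (2 * h ^ 2) := by
        rw [Real.mul_rpow (by norm_num) hτ.le]
        calc T * L * (σs ^ p * ((3 / 2) ^ (2 - p) * τ ^ (2 - p)))
            = (3 / 2) ^ (2 - p) * (T * L * (σs ^ p * τ ^ (2 - p))) := by ring
          _ ≤ _ := by gcongr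
      have := mul_le_mul_of_nonneg_left d1 (by positivity : 0 ≤ G ^ 2 * L)
      rw [varBound]
      linarith

end Bounds

/-! ### Exponential supermartingales over independent samples -/

section Recursion

variable {Z Ξ : Type*}

/-- The state reached from `z₀` after feeding the samples `s 0, …, s (n - 1)` to the recursion
`Φ`. -/
def foldSamples (Φ : Z → Ξ → Z) (z₀ : Z) : (n : ℕ) → (Fin n → Ξ) → Z
  | 0, _ => z₀
  | n + 1, s => Φ (foldSamples Φ z₀ n (fun i => s i.castSucc)) (s (Fin.last n))

variable [MeasurableSpace Z] [MeasurableSpace Ξ]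

theorem measurable_foldSamples {Φ : Z → Ξ → Z} (hΦ : Measurable (Function.uncurry Φ)) (z₀ : Z) :
    ∀ n, Measurable (foldSamples Φ z₀ n)
  | 0 => measurable_const
  | n + 1 => hΦ.comp (((measurable_foldSamples hΦ z₀ n).comp
      (measurable_pi_lambda _ fun _ => measurable_pi_apply _)).prodMk (measurable_pi_apply _))

/-- A supermartingale estimate without conditional expectations: by Tonelli the last sample is
integrated first, for frozen earlier ones, and `hstep` holds at every state. -/
theorem lintegral_foldSamples_le {Φ : Z → Ξ → Z} (hΦ : Measurable (Function.uncurry Φ))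
    {V : Z → ENNReal} (hV : Measurable V) {μ : Measure Ξ} [IsProbabilityMeasure μ] {c : ENNReal}
    (hstep : ∀ z, ∫⁻ ξ, V (Φ z ξ) ∂μ ≤ c * V z) (z₀ : Z) (n : ℕ) :
    ∫⁻ s, V (foldSamples Φ z₀ n s) ∂(Measure.pi fun _ : Fin n => μ) ≤ c ^ n * V z₀ := by
  induction n with
  | zero => simp [foldSamples]
  | succ n ih =>
    have hm := measurable_foldSamples hΦ z₀
    have hmp := measurePreserving_piFinSuccAbove (fun _ : Fin (n + 1) => μ) (Fin.last n)
    have hF : Measurable fun q : Ξ × (Fin n → Ξ) => V (Φ (foldSamples Φ z₀ n q.2) q.1) :=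
      hV.comp (hΦ.comp (((hm n).comp measurable_snd).prodMk measurable_fst))
    calc ∫⁻ s, V (foldSamples Φ z₀ (n + 1) s) ∂(Measure.pi fun _ : Fin (n + 1) => μ)
        = ∫⁻ s, (fun q : Ξ × (Fin n → Ξ) => V (Φ (foldSamples Φ z₀ n q.2) q.1))
            (MeasurableEquiv.piFinSuccAbove (fun _ => Ξ) (Fin.last n) s)
            ∂(Measure.pi fun _ : Fin (n + 1) => μ) := by
          refine lintegral_congr fun s => ?_
          simp [foldSamples, MeasurableEquiv.piFinSuccAbove, Fin.insertNthEquiv, Fin.removeNth_last,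
            Fin.init_def]
      _ = ∫⁻ q, V (Φ (foldSamples Φ z₀ n q.2) q.1)
            ∂(μ.prod (Measure.pi fun _ : Fin n => μ)) := hmp.lintegral_comp hF
      _ = ∫⁻ s, ∫⁻ ξ, V (Φ (foldSamples Φ z₀ n s) ξ) ∂μ ∂(Measure.pi fun _ : Fin n => μ) :=
          lintegral_prod_symm' _ hF
      _ ≤ ∫⁻ s, c * V (foldSamples Φ z₀ n s) ∂(Measure.pi fun _ : Fin n => μ) :=
          lintegral_mono fun s => hstep _
      _ = c * ∫⁻ s, V (foldSamples Φ z₀ n s) ∂(Measure.pi fun _ : Fin n => μ) :=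
          lintegral_const_mul _ (hV.comp (hm n))
      _ ≤ c * (c ^ n * V z₀) := by gcongr
      _ = _ := by rw [pow_succ]; ring

/-- Markov's inequality for the state after `n` independent samples. -/
theorem measure_lt_foldSamples_le {Φ : Z → Ξ → Z} (hΦ : Measurable (Function.uncurry Φ))
    {S : Z → ℝ} (hS : Measurable S) {μ : Measure Ξ} [IsProbabilityMeasure μ] {lam B a : ℝ}
    (hlam : 0 ≤ lam)
    (hstep : ∀ z, ∫⁻ ξ, ENNReal.ofReal (Real.exp (lam * S (Φ z ξ))) ∂μ
      ≤ ENNReal.ofReal (Real.exp B) * ENNReal.ofReal (Real.exp (lam * S z)))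
    {z₀ : Z} (hz₀ : S z₀ = 0) (n : ℕ)
    {Ω : Type*} [MeasurableSpace Ω] {P : Measure Ω} [IsProbabilityMeasure P] {ξ : ℕ → Ω → Ξ}
    (hlaw : ∀ t ∈ Finset.Icc 1 n, HasLaw (ξ t) μ P)
    (hind : iIndepFun (fun t : Finset.Icc 1 n => ξ t) P) :
    P {ω | a < S (foldSamples Φ z₀ n fun i => ξ (i + 1) ω)}
      ≤ ENNReal.ofReal (Real.exp (n * B - lam * a)) := by
  have hmem : ∀ i : Fin n, (i : ℕ) + 1 ∈ Finset.Icc 1 n := fun i => by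
    rw [Finset.mem_Icc]; omega
  -- The samples are numbered from `1`, the coordinates in `Fin n` from `0`.
  have hind' : iIndepFun (fun (i : Fin n) => ξ (i + 1)) P :=
    hind.precomp (g := fun i : Fin n => (⟨i + 1, hmem i⟩ : Finset.Icc 1 n)) fun i j hij => by
      simp only [Subtype.mk.injEq] at hij
      exact Fin.ext (by omega)
  have hae : ∀ i : Fin n, AEMeasurable (ξ (i + 1)) P := fun i => (hlaw _ (hmem i)).aemeasurable
  have hmap : P.map (fun ω (i : Fin n) => ξ (i + 1) ω) = Measure.pi fun _ : Fin n => μ := by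
    rw [(iIndepFun_iff_map_fun_eq_pi_map hae).1 hind']
    congr 1 with i : 1
    exact (hlaw _ (hmem i)).map_eq
  have hV : Measurable fun z => ENNReal.ofReal (Real.exp (lam * S z)) := by fun_prop
  have hset : MeasurableSet {s : Fin n → Ξ | a < S (foldSamples Φ z₀ n s)} :=
    measurableSet_lt measurable_const (hS.comp (measurable_foldSamples hΦ z₀ n))
  calc P {ω | a < S (foldSamples Φ z₀ n fun i => ξ (i + 1) ω)}
      = P.map (fun ω (i : Fin n) => ξ (i + 1) ω) {s | a < S (foldSamples Φ z₀ n s)} := by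
        rw [Measure.map_apply_of_aemeasurable (aemeasurable_pi_lambda _ hae) hset]
        rfl
    _ = (Measure.pi fun _ : Fin n => μ) {s | a < S (foldSamples Φ z₀ n s)} := by rw [hmap]
    _ ≤ (Measure.pi fun _ : Fin n => μ) {s | ENNReal.ofReal (Real.exp (lam * a))
          ≤ ENNReal.ofReal (Real.exp (lam * S (foldSamples Φ z₀ n s)))} := by
        refine measure_mono fun s (hs : a < _) => ENNReal.ofReal_le_ofReal ?_
        exact Real.exp_le_exp.2 (mul_le_mul_of_nonneg_left hs.le hlam)
    _ ≤ (∫⁻ s, ENNReal.ofReal (Real.exp (lam * S (foldSamples Φ z₀ n s)))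
          ∂(Measure.pi fun _ : Fin n => μ)) / ENNReal.ofReal (Real.exp (lam * a)) :=
        meas_ge_le_lintegral_div (hV.comp (measurable_foldSamples hΦ z₀ n)).aemeasurable
          (by simp [Real.exp_pos]) ENNReal.ofReal_ne_top
    _ ≤ (ENNReal.ofReal (Real.exp B) ^ n * ENNReal.ofReal (Real.exp (lam * S z₀)))
          / ENNReal.ofReal (Real.exp (lam * a)) := by
        gcongr
        exact lintegral_foldSamples_le hΦ hV hstep z₀ n
    _ = _ := by
        rw [hz₀, mul_zero, Real.exp_zero, ENNReal.ofReal_one, mul_one,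
          ← ENNReal.ofReal_pow (Real.exp_nonneg _), ← Real.exp_nat_mul,
          ← ENNReal.ofReal_div_of_pos (Real.exp_pos _), ← Real.exp_sub]

end Recursion

/-! ### The stopped error process -/

section Stopped

variable {d : ℕ} {Ξ : Type*} {X : Set (EuclideanSpace ℝ (Fin d))}

/-- One step's contribution of the error of the clipped oracle to the optimality gap. -/
noncomputable def errorTerm (gradf : EuclideanSpace ℝ (Fin d) → EuclideanSpace ℝ (Fin d))
    (g : EuclideanSpace ℝ (Fin d) → Ξ → EuclideanSpace ℝ (Fin d)) (η τ : ℝ)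
    (xstar x : EuclideanSpace ℝ (Fin d)) (ξ : Ξ) : ℝ :=
  inner ℝ (clip τ (g x ξ) - gradf x) (xstar - x) + η * ‖clip τ (g x ξ) - gradf x‖ ^ 2

/-- Run the recursion `step` and accumulate `Y`, until the distance to `xstar` exceeds `R`. -/
noncomputable def stoppedStep (step : X → Ξ → X) (Y : EuclideanSpace ℝ (Fin d) → Ξ → ℝ)
    (xstar : EuclideanSpace ℝ (Fin d)) (R : ℝ) (z : X × ℝ) (ξ : Ξ) : X × ℝ :=
  if ‖xstar - z.1‖ ≤ R then (step z.1 ξ, z.2 + Y z.1 ξ) else z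

/-- A step of proximal Clipped SGD, as a map into `X`. -/
noncomputable def sgdStep {r : EuclideanSpace ℝ (Fin d) → ℝ} {η : ℝ} (hX : IsClosed X)
    (hr : ConvexOn ℝ Set.univ r) (hη : 0 < η)
    (g : EuclideanSpace ℝ (Fin d) → Ξ → EuclideanSpace ℝ (Fin d)) (τ : ℝ) (x : X) (ξ : Ξ) : X :=
  ⟨proxStep X r η (clip τ (g x ξ)) x, proxStep_mem hX hr hη x.2⟩

theorem measurable_stoppedStep [MeasurableSpace Ξ] {step : X → Ξ → X}
    {Y : EuclideanSpace ℝ (Fin d) → Ξ → ℝ} (hstep : Measurable (Function.uncurry step))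
    (hY : Measurable fun q : X × Ξ => Y q.1 q.2) (xstar : EuclideanSpace ℝ (Fin d)) (R : ℝ) :
    Measurable (Function.uncurry (stoppedStep step Y xstar R)) := by
  have hq : Measurable fun q : (X × ℝ) × Ξ => (q.1.1, q.2) := by fun_prop
  refine Measurable.ite (measurableSet_le (by fun_prop) measurable_const) ?_ measurable_fst
  exact (hstep.comp hq).prodMk ((measurable_snd.comp measurable_fst).add (hY.comp hq))

theorem measurable_sgdStep [MeasurableSpace Ξ] {r : EuclideanSpace ℝ (Fin d) → ℝ} {η τ : ℝ}
    (hX : IsClosed X) (hXc : Convex ℝ X) (hr : ConvexOn ℝ Set.univ r) (hη : 0 < η)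
    {g : EuclideanSpace ℝ (Fin d) → Ξ → EuclideanSpace ℝ (Fin d)}
    (hg : Measurable fun q : X × Ξ => g q.1 q.2) :
    Measurable (Function.uncurry (sgdStep hX hr hη g τ)) :=
  ((continuous_proxStep hX hXc hr hη).measurable.comp
    (((measurable_clip τ).comp hg).prodMk measurable_fst)).subtype_mk

theorem measurable_errorTerm [MeasurableSpace Ξ] {η τ : ℝ}
    {gradf : EuclideanSpace ℝ (Fin d) → EuclideanSpace ℝ (Fin d)}
    {g : EuclideanSpace ℝ (Fin d) → Ξ → EuclideanSpace ℝ (Fin d)}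
    (hgrad : Measurable fun x : X => gradf x) (hg : Measurable fun q : X × Ξ => g q.1 q.2)
    (xstar : EuclideanSpace ℝ (Fin d)) :
    Measurable fun q : X × Ξ => errorTerm gradf g η τ xstar q.1 q.2 := by
  have h1 : Measurable fun q : X × Ξ => clip τ (g q.1 q.2) - gradf q.1 :=
    ((measurable_clip τ).comp hg).sub (hgrad.comp measurable_fst)
  have h2 : Measurable fun q : X × Ξ => xstar - (q.1 : EuclideanSpace ℝ (Fin d)) := by fun_prop
  exact (h1.inner h2).add ((h1.norm.pow_const 2).const_mul η)

theorem iterate_mem {r : EuclideanSpace ℝ (Fin d) → ℝ} {η τ : ℝ}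
    (hX : IsClosed X) (hr : ConvexOn ℝ Set.univ r) (hη : 0 < η)
    {g : EuclideanSpace ℝ (Fin d) → Ξ → EuclideanSpace ℝ (Fin d)}
    {x₁ : EuclideanSpace ℝ (Fin d)} (hx₁ : x₁ ∈ X) (s : ℕ → Ξ) :
    ∀ n, iterate X r g (fun _ => η) (fun _ => τ) x₁ s n ∈ X
  | 0 => hx₁
  | n + 1 => proxStep_mem hX hr hη (iterate_mem hX hr hη hx₁ s n)

/-- If the accumulated error of the stopped process is small, then the iterates never leave the
ball of radius `R` about the minimizer, and their total optimality gap is small. -/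
theorem sum_objective_le_of_stopped {f r : EuclideanSpace ℝ (Fin d) → ℝ} {η τ G R a : ℝ}
    {gradf : EuclideanSpace ℝ (Fin d) → EuclideanSpace ℝ (Fin d)}
    {g : EuclideanSpace ℝ (Fin d) → Ξ → EuclideanSpace ℝ (Fin d)}
    (hX : IsClosed X) (hXc : Convex ℝ X) (hr : ConvexOn ℝ Set.univ r)
    (hsub : ∀ x ∈ X, IsSubgradientAt f x (gradf x)) (hG : ∀ x ∈ X, ‖gradf x‖ ≤ G)
    (hη : 0 < η) {xstar x₁ : EuclideanSpace ℝ (Fin d)} (hxs : xstar ∈ X) (hx₁ : x₁ ∈ X)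
    (hmin : IsMinOn (fun x => f x + r x) X xstar) {T : ℕ} {s : ℕ → Ξ} {z : ℕ → X × ℝ}
    (hz0 : z 0 = (⟨x₁, hx₁⟩, 0))
    (hz : ∀ n, z (n + 1) = stoppedStep (sgdStep hX hr hη g τ) (errorTerm gradf g η τ xstar)
      xstar R (z n) (s (n + 1)))
    (hD : ‖xstar - x₁‖ ≤ R) (hR0 : 0 ≤ R)
    (hR : ‖xstar - x₁‖ ^ 2 + 8 * η ^ 2 * G ^ 2 * T + 2 * η * a ≤ R ^ 2)
    (ha : (z T).2 ≤ a) {n : ℕ} (hn : n ≤ T) :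
    ((z n).1 : EuclideanSpace ℝ (Fin d)) = iterate X r g (fun _ => η) (fun _ => τ) x₁ s n ∧
    ‖xstar - iterate X r g (fun _ => η) (fun _ => τ) x₁ s n‖ ≤ R ∧
    ∑ t ∈ Finset.Icc 1 n, ((f (iterate X r g (fun _ => η) (fun _ => τ) x₁ s t)
        + r (iterate X r g (fun _ => η) (fun _ => τ) x₁ s t)) - (f xstar + r xstar))
      ≤ (z n).2 + 4 * η * G ^ 2 * n + (‖xstar - x₁‖ ^ 2
        - ‖xstar - iterate X r g (fun _ => η) (fun _ => τ) x₁ s n‖ ^ 2) / (2 * η) := by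
  set x := iterate X r g (fun _ => η) (fun _ => τ) x₁ s with hx
  have hxX : ∀ n, x n ∈ X := iterate_mem hX hr hη hx₁ s
  induction n with
  | zero => simp [hz0, hx, iterate, hD]
  | succ n ih =>
    obtain ⟨e, hb, hs⟩ := ih (by omega)
    have hz1 : z (n + 1) = (sgdStep hX hr hη g τ (z n).1 (s (n + 1)),
        (z n).2 + errorTerm gradf g η τ xstar (z n).1 (s (n + 1))) := by
      rw [hz, stoppedStep, if_pos (by rw [e]; exact hb)]
    have e1 : ((z (n + 1)).1 : EuclideanSpace ℝ (Fin d)) = x (n + 1) := by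
      rw [hz1]
      simp only [sgdStep, e]
      rfl
    have hstep := objective_proxStep_sub_le (v := clip τ (g (x n) (s (n + 1)))) hX hXc hr hsub hG
      hη (hxX n) hxs
    have hxn : x (n + 1) = proxStep X r η (clip τ (g (x n) (s (n + 1)))) (x n) := rfl
    rw [← hxn] at hstep
    have hsum : ∑ t ∈ Finset.Icc 1 (n + 1), ((f (x t) + r (x t)) - (f xstar + r xstar))
        ≤ (z (n + 1)).2 + 4 * η * G ^ 2 * ((n + 1 : ℕ) : ℝ) + (‖xstar - x₁‖ ^ 2
        - ‖xstar - x (n + 1)‖ ^ 2) / (2 * η) := by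
      rw [Finset.sum_Icc_succ_top (by omega), hz1]
      simp only [errorTerm, e]
      push_cast
      rw [sub_div] at hstep hs ⊢
      linarith
    refine ⟨e1, ?_, hsum⟩
    -- Were `x (n + 1)` outside the ball, the stopped process would stay frozen up to time `T`, so
    -- its present accumulated error would be at most `a`. Nonnegativity of the gaps in `hsum` then
    -- bounds the squared distance by the left side of `hR`, hence by `R²`.
    by_contra! hlt
    have hfrozen : ∀ k, z (n + 1 + k) = z (n + 1) := by
      intro k
      induction k with
      | zero => rfl
      | succ k ihk =>
        rw [← add_assoc, hz, ihk, stoppedStep, if_neg]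
        rw [e1]
        exact not_le.2 hlt
    have hza : (z (n + 1)).2 ≤ a := by
      rw [← hfrozen (T - (n + 1)), Nat.add_sub_cancel' hn]
      exact ha
    have hnn : 0 ≤ ∑ t ∈ Finset.Icc 1 (n + 1), ((f (x t) + r (x t)) - (f xstar + r xstar)) :=
      Finset.sum_nonneg fun t _ => sub_nonneg.2 (hmin (hxX t))
    have hnT : ((n + 1 : ℕ) : ℝ) ≤ T := by exact_mod_cast hn
    have h1 : 4 * η * G ^ 2 * ((n + 1 : ℕ) : ℝ) ≤ 4 * η * G ^ 2 * T := by gcongr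
    have h2 : 0 ≤ a + 4 * η * G ^ 2 * T
        + (‖xstar - x₁‖ ^ 2 - ‖xstar - x (n + 1)‖ ^ 2) / (2 * η) := by linarith
    have h3 := mul_nonneg (by positivity : 0 ≤ 2 * η) h2
    rw [mul_add, mul_div_cancel₀ _ (by positivity)] at h3
    have h4 : R ^ 2 < ‖xstar - x (n + 1)‖ ^ 2 := by gcongr
    nlinarith

theorem objective_avgIterate_le {f r : EuclideanSpace ℝ (Fin d) → ℝ}
    (hf : ConvexOn ℝ Set.univ f) (hr : ConvexOn ℝ Set.univ r)
    (g : EuclideanSpace ℝ (Fin d) → Ξ → EuclideanSpace ℝ (Fin d)) (η τ : ℕ → ℝ)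
    (x₁ : EuclideanSpace ℝ (Fin d)) (s : ℕ → Ξ) {T : ℕ} (hT : 1 ≤ T) (c : ℝ) :
    f (avgIterate X r g η τ x₁ s T) + r (avgIterate X r g η τ x₁ s T) - c
      ≤ 1 / T * ∑ t ∈ Finset.Icc 1 T,
        (f (iterate X r g η τ x₁ s t) + r (iterate X r g η τ x₁ s t) - c) := by
  have hT0 : (0 : ℝ) < T := by exact_mod_cast hT
  have := (hf.add hr).map_sum_le (t := Finset.Icc 1 T) (w := fun _ => 1 / (T : ℝ))
    (p := iterate X r g η τ x₁ s) (fun _ _ => by positivity) (by simp [hT0.ne'])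
    (fun _ _ => Set.mem_univ _)
  rw [← Finset.smul_sum, ← Finset.smul_sum] at this
  rw [Finset.sum_sub_distrib, mul_sub]
  simp only [Pi.add_apply, smul_eq_mul, Finset.sum_const, Nat.card_Icc, add_tsub_cancel_right,
    nsmul_eq_mul] at this ⊢
  rw [← mul_assoc (1 / (T : ℝ)), one_div_mul_cancel hT0.ne', one_mul]
  exact sub_le_sub_right this c

end Stopped

/-! ### Numerical constants and conclusion -/

theorem div_mul_sum_entries_le_rate {p σs σl G D δ : ℝ} {T : ℕ} (hG : 0 < G) (hD : 0 ≤ D)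
    (hl : 0 ≤ σl) (hT : 1 ≤ T) :
    D / T * (G * (phi p σs σl G δ T + Real.log (3 / δ)) + G * √((σl ^ p / G ^ p + 1) * T)
      + domCoeff p σs σl δ * (T : ℝ) ^ (1 / p)) ≤ rate p σs σl G D δ T := by
  have hT0 : (0 : ℝ) < T := by exact_mod_cast hT
  rw [rate, mul_add, mul_add]
  refine add_le_add (add_le_add (le_of_eq (by ring)) ?_) (le_of_eq ?_)
  · have e1 : √((σl ^ p / G ^ p + 1) * T) ≤ (σl ^ (p / 2) / G ^ (p / 2) + 1) * √T := by
      rw [Real.sqrt_mul (by positivity)]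
      refine mul_le_mul_of_nonneg_right (Real.sqrt_le_iff.2 ⟨by positivity, ?_⟩) (Real.sqrt_nonneg _)
      have e2 : ∀ y : ℝ, 0 ≤ y → y ^ p = (y ^ (p / 2)) ^ 2 := fun y hy => by
        rw [← Real.rpow_mul_natCast hy]
        norm_num
      rw [e2 σl hl, e2 G hG.le, ← div_pow]
      have : 0 ≤ σl ^ (p / 2) / G ^ (p / 2) := by positivity
      nlinarith
    calc D / T * (G * √((σl ^ p / G ^ p + 1) * T))
        ≤ D / T * (G * ((σl ^ (p / 2) / G ^ (p / 2) + 1) * √T)) := by gcongr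
      _ = (σl ^ (p / 2) * G ^ (1 - p / 2) + G) * D * (√T / T) := by
        rw [Real.rpow_sub hG, Real.rpow_one]
        field_simp
      _ = _ := by rw [Real.sqrt_div_self', mul_one_div]
  · rw [Real.rpow_sub hT0, Real.rpow_one]
    field_simp

/-- The smallness condition of the exponential moment for `R = 37D`; the left side is at most `(55.5
* 2 + 2.25 * 4) / 222 = 120 / 222`. -/
theorem exponent_mul_le_one {D h τ L η lam : ℝ} (hD : 0 < D) (hh0 : 0 < h) (hτ : 0 < τ)
    (hL : 1 ≤ L) (hηh : η = D / h) (hlamdef : lam = L / (222 * (D * h)))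
    (hτL : τ * L ≤ 2 * h) :
    lam * (3 / 2 * τ * (37 * D) + η * (3 / 2 * τ) ^ 2) ≤ 1 := by
  have e : lam * (3 / 2 * τ * (37 * D) + η * (3 / 2 * τ) ^ 2)
      = (55.5 * (τ * L / h) + 2.25 * (τ ^ 2 * L / h ^ 2)) / 222 := by
    rw [hlamdef, hηh]
    field_simp
    ring
  have e1 : τ * L / h ≤ 2 := (div_le_iff₀ hh0).2 hτL
  have e2 : τ ^ 2 * L / h ^ 2 ≤ 4 := by
    calc τ ^ 2 * L / h ^ 2 ≤ τ ^ 2 * (L * L) / h ^ 2 := by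
          gcongr
          exact le_mul_of_one_le_left (by linarith) hL
      _ = (τ * L / h) ^ 2 := by ring
      _ ≤ 2 ^ 2 := by gcongr
      _ = 4 := by norm_num
  rw [e]
  linarith

/-- In units of `lam D h = L/222`, bias, norm variance and directional variance contribute `222`,
`42` and less than `173`. The level `671` exceeds their sum by more than `222` units, that is by
more than `L`. -/
theorem mul_exponent_sub_le {D h L η lam T b Vl Vs : ℝ} (hD : 0 < D) (hh0 : 0 < h)
    (hL : 0 ≤ L) (hηh : η = D / h) (hlamdef : lam = L / (222 * (D * h)))
    (b1 : T * b ≤ 6 * h) (b2 : T * Vl ≤ 14 * h ^ 2) (b3 : T * L * Vs ≤ 14 * h ^ 2) :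
    T * (lam * (37 * D) * b + 3 * lam * η * Vl + 2 * lam ^ 2 * (37 * D) ^ 2 * Vs)
      - lam * (671 * (D * h)) ≤ -L := by
  have hlam : 0 ≤ lam := hlamdef ▸ by positivity
  have hη : 0 < η := hηh ▸ by positivity
  have e1 : T * (lam * (37 * D) * b + 3 * lam * η * Vl + 2 * lam ^ 2 * (37 * D) ^ 2 * Vs)
      = lam * (37 * D) * (T * b)
      + 3 * lam * η * (T * Vl)
      + 2 * (lam / (222 * (D * h))) * (37 * D) ^ 2 * (T * L * Vs) := by
    rw [show lam ^ 2 = lam / (222 * (D * h)) * L by rw [hlamdef]; ring]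
    ring
  have e2 : T * (lam * (37 * D) * b + 3 * lam * η * Vl + 2 * lam ^ 2 * (37 * D) ^ 2 * Vs)
      ≤ lam * (37 * D) * (6 * h) + 3 * lam * η * (14 * h ^ 2)
      + 2 * (lam / (222 * (D * h))) * (37 * D) ^ 2 * (14 * h ^ 2) := by
    rw [e1]
    gcongr
  have e3 : lam * (37 * D) * (6 * h) + 3 * lam * η * (14 * h ^ 2)
      + 2 * (lam / (222 * (D * h))) * (37 * D) ^ 2 * (14 * h ^ 2)
      = lam * (D * h) * (222 + 42 + 2 * 37 ^ 2 * 14 / 222) := by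
    rw [hηh]
    field_simp
    ring
  have e4 : lam * (D * h) = L / 222 := by
    rw [hlamdef]
    field_simp
  rw [e3, e4] at e2
  rw [show lam * (671 * (D * h)) = 671 * (lam * (D * h)) by ring, e4]
  linarith

theorem measure_objective_le {d : ℕ} {X : Set (EuclideanSpace ℝ (Fin d))} (hX : IsClosed X)
    (hXc : Convex ℝ X) {f r : EuclideanSpace ℝ (Fin d) → ℝ} (hf : ConvexOn ℝ Set.univ f)
    (hr : ConvexOn ℝ Set.univ r) {xstar : EuclideanSpace ℝ (Fin d)} (hxs : xstar ∈ X)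
    (hmin : IsMinOn (fun x => f x + r x) X xstar)
    {gradf : EuclideanSpace ℝ (Fin d) → EuclideanSpace ℝ (Fin d)}
    (hsub : ∀ x ∈ X, IsSubgradientAt f x (gradf x)) {G : ℝ} (hG : 0 < G)
    (hGb : ∀ x ∈ X, ‖gradf x‖ ≤ G) {Ξ : Type*} [MeasurableSpace Ξ] {μ : Measure Ξ}
    [IsProbabilityMeasure μ] {g : EuclideanSpace ℝ (Fin d) → Ξ → EuclideanSpace ℝ (Fin d)}
    {p σs σl : ℝ} (hp1 : 1 < p) (hp : p ≤ 2) (hn : RefinedNoise X gradf g μ p σs σl)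
    {x₁ : EuclideanSpace ℝ (Fin d)} (hx₁ : x₁ ∈ X) (hne : x₁ ≠ xstar) {T : ℕ} (hT : 1 ≤ T)
    {δ : ℝ} (h0 : 0 < δ) (h1 : δ ≤ 1) {Ω : Type*} [MeasurableSpace Ω] {P : Measure Ω}
    [IsProbabilityMeasure P] {ξ : ℕ → Ω → Ξ} (hlaw : ∀ t ∈ Finset.Icc 1 T, HasLaw (ξ t) μ P)
    (hind : iIndepFun (fun t : Finset.Icc 1 T => ξ t) P) :
    ENNReal.ofReal (1 - δ) ≤
      P {ω |
        let η := etaStar p σs σl G ‖xstar - x₁‖ δ T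
        let τ := threshold p σs σl G δ T
        let xbar := avgIterate X r g (fun _ => η) (fun _ => τ) x₁ (fun t => ξ t ω) T
        (f xbar + r xbar) - (f xstar + r xstar) ≤
          676 * rate p σs σl G ‖xstar - x₁‖ δ T} := by
  have hT0 : (0 : ℝ) < T := by exact_mod_cast hT
  have hL := one_le_log_three_div h0 h1
  have hs := hn.σs_nonneg
  have hl := hn.σl_nonneg
  have hsl := hn.σs_le_σl
  have hD : 0 < ‖xstar - x₁‖ := norm_pos_iff.2 (sub_ne_zero.2 hne.symm)
  have hτ2 := two_mul_le_threshold (p := p) (σs := σs) (σl := σl) (G := G) (δ := δ) (T := T)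
  have hrate := div_mul_sum_entries_le_rate (p := p) (σs := σs) (δ := δ) hG hD.le hl hT
  obtain ⟨hη, k1, k2, k3, k4⟩ := etaStar_spec (p := p) (T := T) hp1 hG hD hs hl hsl hn.σs_pos h0 h1
    hT
  set D := ‖xstar - x₁‖ with hDdef
  set η := etaStar p σs σl G D δ T with hηdef
  set τ := threshold p σs σl G δ T with hτdef
  set L := Real.log (3 / δ) with hLdef
  obtain ⟨h, hh⟩ : ∃ h, h = D / η := ⟨_, rfl⟩
  have hh0 : 0 < h := hh ▸ by positivity
  have hηh : η = D / h := by rw [hh, div_div_cancel₀ hD.ne']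
  rw [← hh] at k1 k2 k3 k4
  obtain ⟨b1, b2, b3⟩ := bounds_of_params hp1 hp hG hs hl hsl hn.σs_pos h0 h1 hT hh0 k1 k2 k3
  have hτL := threshold_mul_log_le (T := T) hp1 hG hs hl hsl hn.σs_pos h0 h1 hh0 k1 k3
  rw [← hτdef] at b1 b2 b3 hτL
  rw [← hLdef] at b3 hτL
  have hτ : 0 < τ := by linarith
  have hGT : G ^ 2 * T ≤ h ^ 2 := by
    have k : (G * √((σl ^ p / G ^ p + 1) * T)) ^ 2 ≤ h ^ 2 := by gcongr
    rw [mul_pow, Real.sq_sqrt (by positivity)] at k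
    have : 0 ≤ G ^ 2 * (σl ^ p / G ^ p * T) := by positivity
    linarith
  set lam := L / (222 * (D * h)) with hlamdef
  have hlam : 0 ≤ lam := by positivity
  have hsmall : lam * (3 / 2 * τ * (37 * D) + η * (3 / 2 * τ) ^ 2) ≤ 1 :=
    exponent_mul_le_one hD hh0 hτ hL hηh rfl hτL
  set B := lam * (37 * D) * biasBound p σs σl G τ + 3 * lam * η * varBound p σl σl G τ
    + 2 * lam ^ 2 * (37 * D) ^ 2 * varBound p σs σl G τ with hB
  have hB0 : 0 ≤ B := by
    have : 0 < D := hD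
    unfold biasBound varBound at hB
    rw [hB]
    positivity
  have hTB : T * B - lam * (671 * (D * h)) ≤ -L :=
    mul_exponent_sub_le hD hh0 (by linarith) hηh rfl b1 b2 b3
  set Φ := stoppedStep (sgdStep hX hr hη g τ) (errorTerm gradf g η τ xstar) xstar (37 * D) with hΦ
  have hΦm : Measurable (Function.uncurry Φ) :=
    measurable_stoppedStep (measurable_sgdStep hX hXc hr hη hn.measurable_oracle)
      (measurable_errorTerm hn.measurable_gradf hn.measurable_oracle xstar) xstar _
  have hstep : ∀ z : X × ℝ, ∫⁻ ξ, ENNReal.ofReal (Real.exp (lam * (Φ z ξ).2)) ∂μ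
      ≤ ENNReal.ofReal (Real.exp B) * ENNReal.ofReal (Real.exp (lam * z.2)) := by
    intro z
    by_cases hz : ‖xstar - z.1‖ ≤ 37 * D
    · have := hn.integral_exp_le hp1 hp hτ (by linarith) z.1.2 (hGb _ z.1.2) hlam hη.le hsmall hz
      simp only [hΦ, stoppedStep, if_pos hz, mul_add, Real.exp_add,
        ENNReal.ofReal_mul (Real.exp_nonneg _)]
      rw [lintegral_const_mul' _ _ ENNReal.ofReal_ne_top, mul_comm]
      rw [← hB] at this
      gcongr
      refine le_trans (le_of_eq ?_) this
      simp only [errorTerm, mul_add, Real.exp_add, ENNReal.ofReal_mul (Real.exp_nonneg _)]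
    -- Outside the ball the process is frozen, and `B ≥ 0` suffices.
    · simp only [hΦ, stoppedStep, if_neg hz, lintegral_const, measure_univ, mul_one]
      refine le_mul_of_one_le_left zero_le ?_
      rw [ENNReal.one_le_ofReal]
      exact Real.one_le_exp hB0
  set z₀ : X × ℝ := (⟨x₁, hx₁⟩, 0) with hz₀
  have hbad := measure_lt_foldSamples_le (Z := X × ℝ) (S := Prod.snd) (a := 671 * (D * h)) hΦm
    measurable_snd hlam hstep (z₀ := z₀) rfl T hlaw hind
  have hδ : Real.exp (T * B - lam * (671 * (D * h))) ≤ δ := by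
    calc _ ≤ Real.exp (-L) := Real.exp_le_exp.2 hTB
      _ = δ / 3 := by rw [Real.exp_neg, hLdef, Real.exp_log (by positivity), inv_div]
      _ ≤ δ := by linarith
  rw [ENNReal.ofReal_sub _ h0.le, ENNReal.ofReal_one, tsub_le_iff_right]
  refine le_trans ?_ (add_le_add_right (hbad.trans (ENNReal.ofReal_le_ofReal hδ)) _)
  rw [← measure_univ (μ := P)]
  refine (measure_mono fun ω _ => ?_).trans (measure_union_le _ _)
  rcases lt_or_ge (671 * (D * h)) (foldSamples Φ z₀ T fun i => ξ (i + 1) ω).2 with hlt | hle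
  · exact Or.inr hlt
  left
  -- Self-consistency of the radius: `1 + 8 + 2 * 671 = 1351 ≤ 1369 = 37²`, so an error of at most
  -- `671Dh` keeps the iterates in the ball in which it was estimated.
  have hR : D ^ 2 + 8 * η ^ 2 * G ^ 2 * T + 2 * η * (671 * (D * h)) ≤ (37 * D) ^ 2 := by
    have e : 8 * η ^ 2 * G ^ 2 * T ≤ 8 * D ^ 2 := by
      calc 8 * η ^ 2 * G ^ 2 * T = 8 * η ^ 2 * (G ^ 2 * T) := by ring
        _ ≤ 8 * η ^ 2 * h ^ 2 := by gcongr
        _ = 8 * D ^ 2 := by rw [hηh]; field_simp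
    have e' : 2 * η * (671 * (D * h)) = 1342 * D ^ 2 := by
      rw [hηh]; field_simp; ring
    rw [e']
    linarith [sq_nonneg D]
  obtain ⟨-, -, hsum⟩ := sum_objective_le_of_stopped (T := T) (n := T) (s := fun t => ξ t ω)
    (z := fun n => foldSamples Φ z₀ n fun i => ξ (i + 1) ω) hX hXc hr hsub hGb hη hxs hx₁ hmin
    rfl (fun n => rfl) (by linarith : D ≤ 37 * D) (by linarith) hR hle le_rfl
  have havg := objective_avgIterate_le (X := X) hf hr g (fun _ => η) (fun _ => τ) x₁
    (fun t => ξ t ω) hT (f xstar + r xstar)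
  have hη4 : 4 * η * G ^ 2 * T ≤ 4 * (D * h) := by
    calc 4 * η * G ^ 2 * T = 4 * η * (G ^ 2 * T) := by ring
      _ ≤ 4 * η * h ^ 2 := by gcongr
      _ = 4 * (D * h) := by rw [hηh]; field_simp
  have hDη : (D ^ 2 - ‖xstar - iterate X r g (fun _ => η) (fun _ => τ) x₁ (fun t => ξ t ω) T‖ ^ 2)
      / (2 * η) ≤ D * h := by
    have e : D * h * (2 * η) = 2 * D ^ 2 := by
      rw [hηh]
      field_simp
    rw [div_le_iff₀ (by positivity), e]
    exact (sub_le_self _ (sq_nonneg _)).trans (by linarith [sq_nonneg D])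
  refine havg.trans ?_
  -- `676 = 671 + 4 + 1`, from the accumulated error, the terms `4ηG²` and the initial distance.
  calc _ ≤ 1 / (T : ℝ) * (676 * (D * h)) := by
        refine mul_le_mul_of_nonneg_left (hsum.trans ?_) (by positivity)
        linarith
    _ = 676 * (D / T * h) := by ring
    _ ≤ 676 * rate p σs σl G D δ T := by
        refine mul_le_mul_of_nonneg_left (le_trans ?_ hrate) (by norm_num)
        gcongr

end ClippedSGD

theorem mainTheorem1 :
    ∃ C : ℝ, 0 < C ∧
      ∀ (d : ℕ) (X : Set (EuclideanSpace ℝ (Fin d))) (_ : IsClosed X) (_ : Convex ℝ X)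
        (f r : EuclideanSpace ℝ (Fin d) → ℝ)
        (_ : ConvexOn ℝ Set.univ f) (_ : ConvexOn ℝ Set.univ r)
        -- the minimizer `xstar` of `F = f + r` on `X`
        (xstar : EuclideanSpace ℝ (Fin d)) (_ : xstar ∈ X)
        (_ : IsMinOn (fun x => f x + r x) X xstar)
        -- the subgradients `∇f(x) ∈ ∂f(x)`, bounded by `G` on `X`
        (gradf : EuclideanSpace ℝ (Fin d) → EuclideanSpace ℝ (Fin d))
        (_ : ∀ x ∈ X, ClippedSGD.IsSubgradientAt f x (gradf x))
        (G : ℝ) (_ : 0 < G) (_ : ∀ x ∈ X, ‖gradf x‖ ≤ G)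
        -- the stochastic oracle
        (Ξ : Type*) (_ : MeasurableSpace Ξ) (μ : Measure Ξ) (_ : IsProbabilityMeasure μ)
        (g : EuclideanSpace ℝ (Fin d) → Ξ → EuclideanSpace ℝ (Fin d))
        (p σs σl : ℝ) (_ : 1 < p) (_ : p ≤ 2)
        (_ : ClippedSGD.RefinedNoise X gradf g μ p σs σl)
        -- initial point, horizon, failure probability
        (x₁ : EuclideanSpace ℝ (Fin d)) (_ : x₁ ∈ X) (_ : x₁ ≠ xstar)
        (T : ℕ) (_ : 1 ≤ T) (δ : ℝ) (_ : 0 < δ) (_ : δ ≤ 1)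
        -- independent samples `ξ 1, …, ξ T` with distribution `μ`
        (Ω : Type*) (_ : MeasurableSpace Ω) (P : Measure Ω) (_ : IsProbabilityMeasure P)
        (ξ : ℕ → Ω → Ξ) (_ : ∀ t ∈ Finset.Icc 1 T, HasLaw (ξ t) μ P)
        (_ : iIndepFun (fun t : Finset.Icc 1 T => ξ t) P),
        -- `φ ≤ φ⋆`, with equality for `T ≥ 2 ^ p * (G ^ p / σl ^ p) * φ⋆`
        (ClippedSGD.phi p σs σl G δ T ≤ ClippedSGD.phiStar p σs σl δ ∧
          (2 ^ p * (G ^ p / σl ^ p) * ClippedSGD.phiStar p σs σl δ ≤ T →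
            ClippedSGD.phi p σs σl G δ T = ClippedSGD.phiStar p σs σl δ)) ∧
        -- the rate, with probability at least `1 - δ`
        ENNReal.ofReal (1 - δ) ≤
          P {ω |
            let η := ClippedSGD.etaStar p σs σl G ‖xstar - x₁‖ δ T
            let τ := ClippedSGD.threshold p σs σl G δ T
            let xbar := ClippedSGD.avgIterate X r g (fun _ => η) (fun _ => τ) x₁
              (fun t => ξ t ω) T
            (f xbar + r xbar) - (f xstar + r xstar) ≤
              C * ClippedSGD.rate p σs σl G ‖xstar - x₁‖ δ T} ∧
        -- the coefficient of the dominant term through the generalized effective dimension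
        (0 < σl →
          ClippedSGD.domCoeff p σs σl δ =
            σl * (ClippedSGD.dEff σs σl ^ (-((2 - p) / (2 * p))) +
              ClippedSGD.dEff σs σl ^ (-(1 / (2 * p))) *
                Real.log (3 / δ) ^ (1 - 1 / p))) := by
  refine ⟨676, by norm_num, ?_⟩
  intro d X hX hXc f r hf hr xstar hxs hmin gradf hsub G hG hGb Ξ _ μ _ g p σs σl hp1 hp hn
    x₁ hx₁ hne T hT δ h0 h1 Ω _ P _ ξ hlaw hind
  exact ⟨⟨ClippedSGD.phi_le_phiStar hG hn.σl_nonneg h0 h1,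
    ClippedSGD.phi_eq_phiStar hG hn.σl_nonneg h0 h1⟩,
    ClippedSGD.measure_objective_le hX hXc hf hr hxs hmin hsub hG hGb hp1 hp hn hx₁ hne hT h0 h1
      hlaw hind,
    fun hl => ClippedSGD.domCoeff_eq hp1 (hn.σs_pos hl) hl⟩
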